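/- Let $m\ge 3$ be an integer. A banded plane partition of width $m$ is a finitely supported function $f:\mathbb T_m\to\mathbb N$ on $\mathbb T_m=\{(i,j)\in\mathbb N^2: j\le i\le j+m-1\}$ (with $0\in\mathbb N$) such that $f(i,j)\ge f(i,j+1)$ and $f(i,j)\ge f(i+1,j)$ whenever both cells involved lie in $\mathbb T_m$; its size is $\sum_{(i,j)\in\mathbb T_m} f(i,j)$. Let $G_{n,m}$ be the number of banded plane partitions of width $m$ and size $n$, and let $G_m(z)=\sum_{n\ge0}G_{n,m}z^n$. Let $P(z)=\prod_{k\ge1}(1-z^k)^{-1}$ for $|z|<1$. Powers of $P$ (and the square root of a quotient of values of $P$) are defined through the branch of the logarithm $\log P(z)=-\sum_{k\ge1}\operatorname{Log}(1-z^k)$, where $\operatorname{Log}$ is the principal logarithm. Set $$g_m=(2\pi)^{-(m^2-3m+4)/4}\prod_{1\le k<j<m}\Gamma\!\left(\frac{k+j}{2m}\right),\qquad \varpi_m=\frac{\pi^2}{24}\left(m+1+\frac2m\right),\qquad \phi_m=\frac{m^3-7m+2}{96},$$ $$K_m(z)=\sqrt{\frac{P(z^{1/m})}{P(z^{1/2})}}\;P(z)^{(m+2)/4},$$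 $$L_m(z)=\exp\left(-\frac1{2m}\sum_{1\le \ell\le m}\frac{\cos\left(\frac{(2\ell-1)\pi}{m}\right)}{1-\cos\left(\frac{(2\ell-1)\pi}{m}\right)}\sum_{j\ge0}\frac{z^{\,j+\frac{2\ell-1}{2m}}}{\left(j+\frac{2\ell-1}{2m}\right)\left(1-z^{\,j+\frac{2\ell-1}{2m}}\right)}\right).$$ Then for every complex $\tau$ with $\operatorname{Re}\tau>0$ the series for $G_m(e^{-\tau})$ converges absolutely and $$G_m(e^{-\tau})=g_m\sqrt{\tau}\,\exp\left(\frac{\varpi_m}{\tau}+\phi_m\tau\right)K_m\!\left(e^{-4\pi^2/\tau}\right)L_m\!\left(e^{-4\pi^2/\tau}\right),$$ where $\sqrt\tau$ is the principal square root and where the powers $z^a$ of $z=e^{-4\pi^2/\tau}$ in $K_m$ and $L_m$ are read as $e^{-4\pi^2a/\tau}$. If $|\operatorname{Im}(4\pi^2/\tau)|<\pi$, these are the principal powers of $z$, so the identity then holds with principal powers. With principal powers of $z$, both $K_m(z)$ and $L_m(z)$ are analytic in $|z|<1$, $z\notin[-1,0]$. -/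

import Mathlib

noncomputable section

/-- The stair-shaped region `{(i, j) ∈ ℕ² : j ≤ i ≤ j + m - 1}` (for `m ≥ 1`). -/
def stairRegion (m : ℕ) : Set (ℕ × ℕ) :=
  {p | p.2 ≤ p.1 ∧ p.1 < p.2 + m}

/-- A finitely supported `f : stairRegion m → ℕ` is a banded plane partition of width `m` if
`f (i, j) ≥ f (i, j + 1)` and `f (i, j) ≥ f (i + 1, j)` whenever both cells lie in the region. -/
structure IsBandedPlanePartition (m : ℕ) (f : stairRegion m →₀ ℕ) : Prop where
  col : ∀ p q : stairRegion m, q.1.1 = p.1.1 → q.1.2 = p.1.2 + 1 → f q ≤ f p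
  row : ∀ p q : stairRegion m, q.1.1 = p.1.1 + 1 → q.1.2 = p.1.2 → f q ≤ f p

/-- The number `G_{n,m}` of banded plane partitions of size `n` and width `m`. -/
def bppCount (m n : ℕ) : ℕ :=
  Set.ncard {f : stairRegion m →₀ ℕ | IsBandedPlanePartition m f ∧ (f.sum fun _ a => a) = n}

/-- The generating function `G_m(z) = ∑ₙ G_{n,m} zⁿ`. -/
def bppGF (m : ℕ) (z : ℂ) : ℂ :=
  ∑' n : ℕ, (bppCount m n : ℂ) * z ^ n

/-- The partition generating function `P(z) = ∏_{k ≥ 1} 1 / (1 - zᵏ)`. -/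
def partGF (z : ℂ) : ℂ :=
  ∏' k : ℕ, (1 - z ^ (k + 1))⁻¹

/-- The branch of `log P` on the unit disc that vanishes at `0`. Since `1 - zᵏ` has positive real
part for `|z| < 1`, each summand is analytic there. -/
def logPartGF (z : ℂ) : ℂ :=
  ∑' k : ℕ, -Complex.log (1 - z ^ (k + 1))

/-- `K_m` as a function of a logarithm `s` of its argument: with `z = eˢ` and `zᵃ = e^{a s}`,
`√(P(z^{1/m}) / P(z^{1/2})) · P(z)^{(m+2)/4}`, the powers of `P` being taken
through `logPartGF`. -/
def KLog (m : ℕ) (s : ℂ) : ℂ :=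
  Complex.exp ((logPartGF (Complex.exp (s / m)) - logPartGF (Complex.exp (s / 2))) / 2) *
    Complex.exp (((m : ℂ) + 2) / 4 * logPartGF (Complex.exp s))

/-- The exponent `j + (2ℓ - 1) / (2m)`. -/
def lambertExponent (m l j : ℕ) : ℝ :=
  j + (2 * l - 1) / (2 * m)

/-- The term `zᵇ / (b (1 - zᵇ))`, where `zᵇ = e^{b s}`. -/
def lambertTerm (b : ℝ) (s : ℂ) : ℂ :=
  Complex.exp (b * s) / (b * (1 - Complex.exp (b * s)))

/-- `L_m` as a function of a logarithm `s` of its argument `z = eˢ` (with `zᵇ = e^{b s}`). -/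
def LLog (m : ℕ) (s : ℂ) : ℂ :=
  Complex.exp (-(1 / (2 * (m : ℂ))) * ∑ l ∈ Finset.Icc 1 m,
    ((Real.cos ((2 * l - 1) * Real.pi / m) /
      (1 - Real.cos ((2 * l - 1) * Real.pi / m)) : ℝ) : ℂ) *
      ∑' j : ℕ, lambertTerm (lambertExponent m l j) s)

/-- `K_m(z)`, with principal powers of `z`. -/
def KFun (m : ℕ) (z : ℂ) : ℂ := KLog m (Complex.log z)

/-- `L_m(z)`, with principal powers of `z`. -/
def LFun (m : ℕ) (z : ℂ) : ℂ := LLog m (Complex.log z)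

/-- `g_m = (2π)^{-(m² - 3m + 4)/4} ∏_{1 ≤ k < j < m} Γ((k + j) / (2m))`. -/
def gConst (m : ℕ) : ℝ :=
  (2 * Real.pi) ^ (-(((m : ℝ) ^ 2 - 3 * m + 4) / 4)) *
    ∏ j ∈ Finset.Ico 1 m, ∏ k ∈ Finset.Ico 1 j, Real.Gamma (((k : ℝ) + j) / (2 * m))

/-- `ϖ_m = (π² / 24) (m + 1 + 2 / m)`. -/
def varpiConst (m : ℕ) : ℝ :=
  Real.pi ^ 2 / 24 * ((m : ℝ) + 1 + 2 / m)

/-- `φ_m = (m³ - 7m + 2) / 96`. -/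
def phiConst (m : ℕ) : ℝ :=
  ((m : ℝ) ^ 3 - 7 * m + 2) / 96

/-- The unit disc slit along `[-1, 0]`. -/
def slitDisc : Set ℂ :=
  {z | ‖z‖ < 1 ∧ ∀ x : ℝ, x ∈ Set.Icc (-1 : ℝ) 0 → z ≠ (x : ℂ)}

theorem summable_log_partGF {z : ℂ} (hz : ‖z‖ < 1) :
    Summable fun k : ℕ => -Complex.log (1 - z ^ (k + 1)) := by
  have h : Summable fun k : ℕ => -z ^ (k + 1) :=
    (((summable_geometric_of_norm_lt_one hz).mul_right z).congr fun k => (pow_succ z k).symm).neg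
  simpa [sub_eq_add_neg] using (Complex.summable_log_one_add_of_summable h).neg

/-- `logPartGF` is a logarithm of `P` on the unit disc. -/
theorem exp_logPartGF {z : ℂ} (hz : ‖z‖ < 1) : Complex.exp (logPartGF z) = partGF z := by
  have hne : ∀ k : ℕ, 1 - z ^ (k + 1) ≠ 0 := by
    intro k h
    have h1 : ‖z ^ (k + 1)‖ = 1 := by rw [← sub_eq_zero.1 h, norm_one]
    rw [norm_pow] at h1
    exact (pow_lt_one₀ (norm_nonneg z) hz (Nat.succ_ne_zero k)).ne h1
  have hs : HasSum (fun k : ℕ => -Complex.log (1 - z ^ (k + 1))) (logPartGF z) :=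
    (summable_log_partGF hz).hasSum
  have hp : HasProd (fun k : ℕ => Complex.exp (-Complex.log (1 - z ^ (k + 1))))
      (Complex.exp (logPartGF z)) := hs.cexp
  have hfun : (fun k : ℕ => Complex.exp (-Complex.log (1 - z ^ (k + 1)))) =
      fun k : ℕ => (1 - z ^ (k + 1))⁻¹ := by
    funext k
    rw [Complex.exp_neg, Complex.exp_log (hne k)]
  rw [hfun] at hp
  exact hp.tprod_eq.symm

theorem logPartGF_zero : logPartGF 0 = 0 := by
  simp [logPartGF]

/-- `logPartGF` is analytic on the unit disc. -/
theorem analyticOnNhd_logPartGF : AnalyticOnNhd ℂ logPartGF (Metric.ball 0 1) := by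
  refine DifferentiableOn.analyticOnNhd (fun z hz => ?_) Metric.isOpen_ball
  obtain ⟨r, hzr, hr1⟩ := exists_between (mem_ball_zero_iff.1 hz)
  have hr0 : 0 ≤ r := (norm_nonneg z).trans hzr.le
  have hpow : ∀ w ∈ Metric.ball (0 : ℂ) r, ∀ k : ℕ, ‖-w ^ (k + 1)‖ ≤ r ^ (k + 1) := by
    intro w hw k
    rw [norm_neg, norm_pow]
    exact pow_le_pow_left₀ (norm_nonneg w) (mem_ball_zero_iff.1 hw).le _
  have hlt : ∀ k : ℕ, r ^ (k + 1) ≤ r := fun k => by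
    simpa using pow_le_of_le_one hr0 hr1.le (Nat.succ_ne_zero k)
  have key : DifferentiableOn ℂ logPartGF (Metric.ball 0 r) := by
    have hu : Summable fun k : ℕ => (1 - r)⁻¹ * r ^ (k + 1) :=
      ((summable_nat_add_iff 1).2 (summable_geometric_of_lt_one hr0 hr1)).mul_left _
    refine Complex.differentiableOn_tsum_of_summable_norm (u := fun k : ℕ => (1 - r)⁻¹ * r ^ (k + 1) *
      ((1 - r) * (r * (1 - r)⁻¹ / 2 + 1))) (hu.mul_right _) (fun k => ?_) Metric.isOpen_ball
      (fun k w hw => ?_)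
    · refine DifferentiableOn.neg (DifferentiableOn.clog (by fun_prop) fun w hw => Or.inl ?_)
      have h1 := hpow w hw k
      rw [norm_neg] at h1
      have h2 := (Complex.re_le_norm (w ^ (k + 1))).trans (h1.trans (hlt k))
      simp only [Complex.sub_re, Complex.one_re]
      linarith
    · have h1 := hpow w hw k
      have h2 := Complex.norm_log_one_add_le (h1.trans_lt ((hlt k).trans_lt hr1))
      rw [norm_neg, sub_eq_add_neg]
      have h1r : 0 < 1 - r := by linarith
      have hinv : (1 - ‖-w ^ (k + 1)‖)⁻¹ ≤ (1 - r)⁻¹ :=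
        inv_anti₀ h1r (by linarith [h1.trans (hlt k)])
      have h3 : ‖-w ^ (k + 1)‖ ^ 2 ≤ r ^ (k + 1) * r := by
        rw [sq]
        exact mul_le_mul h1 (h1.trans (hlt k)) (norm_nonneg _) (pow_nonneg hr0 _)
      have h4 : ‖-w ^ (k + 1)‖ ^ 2 * (1 - ‖-w ^ (k + 1)‖)⁻¹ ≤ r ^ (k + 1) * r * (1 - r)⁻¹ :=
        mul_le_mul h3 hinv (inv_nonneg.2 (by linarith [h1.trans (hlt k)]))
          (mul_nonneg (pow_nonneg hr0 _) hr0)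
      calc _ ≤ r ^ (k + 1) * r * (1 - r)⁻¹ / 2 + r ^ (k + 1) := by linarith
        _ = _ := by field_simp
  exact (key.differentiableAt (Metric.isOpen_ball.mem_nhds
    (mem_ball_zero_iff.2 hzr))).differentiableWithinAt

/-- For `|z| < 1` and `z ≠ 0` this is the formula `√(P(z^{1/m}) / P(z^{1/2})) · P(z)^{(m+2)/4}`
with principal powers of `z`. -/
theorem KFun_eq (m : ℕ) {z : ℂ} (hz : z ≠ 0) :
    KFun m z =
      Complex.exp ((logPartGF (z ^ (1 / (m : ℂ))) - logPartGF (z ^ (1 / 2 : ℂ))) / 2) *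
        Complex.exp (((m : ℂ) + 2) / 4 * logPartGF z) := by
  simp only [KFun, KLog, Complex.cpow_def_of_ne_zero hz, Complex.exp_log hz, mul_one_div]

theorem lambertTerm_log (b : ℝ) {z : ℂ} (hz : z ≠ 0) :
    lambertTerm b (Complex.log z) = z ^ (b : ℂ) / (b * (1 - z ^ (b : ℂ))) := by
  simp only [lambertTerm, Complex.cpow_def_of_ne_zero hz, mul_comm]

/-- The inner series in `L_m` converges absolutely. -/
theorem summable_lambertTerm {m l : ℕ} (hm : 0 < m) (hl : 1 ≤ l) {s : ℂ} (hs : s.re < 0) :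
    Summable fun j : ℕ => lambertTerm (lambertExponent m l j) s := by
  have hm' : (0 : ℝ) < m := by exact_mod_cast hm
  have hl' : (1 : ℝ) ≤ l := by exact_mod_cast hl
  set c : ℝ := (2 * l - 1) / (2 * m) with hc
  have hc0 : 0 < c := div_pos (by linarith) (by linarith)
  have hnorm : ∀ b : ℝ, ‖Complex.exp (b * s)‖ = Real.exp (b * s.re) := fun b => by
    simp [Complex.norm_exp]
  have hq : Real.exp (c * s.re) < 1 := Real.exp_lt_one_iff.2 (mul_neg_of_pos_of_neg hc0 hs)
  refine Summable.of_norm_bounded (g := fun j : ℕ =>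
    Real.exp s.re ^ j * (c * (1 - Real.exp (c * s.re)))⁻¹)
    ((summable_geometric_of_lt_one (Real.exp_nonneg _) (Real.exp_lt_one_iff.2 hs)).mul_right _)
    (fun j => ?_)
  have hb : lambertExponent m l j = j + c := rfl
  have hj : (0 : ℝ) ≤ j := Nat.cast_nonneg j
  have hbe : Real.exp ((j + c) * s.re) ≤ Real.exp (c * s.re) :=
    Real.exp_le_exp.2 (by nlinarith)
  have hbj : Real.exp ((j + c) * s.re) ≤ Real.exp s.re ^ j := by
    rw [← Real.exp_nat_mul]
    exact Real.exp_le_exp.2 (by nlinarith)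
  have hden : c * (1 - Real.exp (c * s.re)) ≤
      (j + c) * ‖1 - Complex.exp (((j + c : ℝ) : ℂ) * s)‖ := by
    have h1 := norm_sub_norm_le (1 : ℂ) (Complex.exp (((j + c : ℝ) : ℂ) * s))
    rw [norm_one, hnorm] at h1
    exact mul_le_mul (by linarith) (by linarith) (by linarith) (by linarith)
  rw [lambertTerm, hb, norm_div, norm_mul, hnorm, Complex.norm_real, Real.norm_eq_abs,
    abs_of_pos (by linarith : 0 < (j : ℝ) + c), div_eq_mul_inv]
  exact mul_le_mul hbj (inv_anti₀ (mul_pos hc0 (by linarith)) hden)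
    (inv_nonneg.2 (mul_nonneg (by linarith) (norm_nonneg _))) (pow_nonneg (Real.exp_nonneg _) _)

end

/-! Write `m = n + 1` and read an array along its diagonals. The two monotonicity conditions say
exactly that consecutive diagonals are interlacing partitions, so banded plane partitions are chains
of `n` horizontal strips with free partitions at both ends. Two identities for the operators that
add and remove a strip determine the generating function: the skew Cauchy commutation
`addStrip_removeStrip`, and its special case `addStrip_one`, which reflects a strip at a free
boundary. Reflecting every strip once at each boundary multiplies the strip parameters by `u = q ^
m` and produces an explicit factor (`freeBoundarySum_eq_mul`). Under iteration the parameters tend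
to zero, and what remains is the generating function of a single partition. Thus G_m(q) is P(q)
times the product of (1 - q^(2mi + k + j))⁻¹ over i ≥ 0 and 1 ≤ k < j < m. All of this takes place
in `ℝ≥0∞`, where sums may be interchanged freely. For q = e^(-T) the logarithm of the product is a
sum of values of `logQGamma`. The pairs (k, j) are symmetric under k + j ↦ 2m - (k + j), so only the
sums `logQGamma a T + logQGamma (1 - a) T` occur. These have a transformation T ↦ 4π²/T
(`logQGamma_add_logQGamma_one_sub`): their Lambert series is a series of hyperbolic quotients, each
expands in a Fourier series, and interchanging the two summations gives hyperbolic quotients at the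
inverted argument. The limit a → 0 gives the transformation of P itself (`logQGamma_one_eq`). In the
sum over pairs, the terms in 1/T and T give ϖ_m and φ_m, the sines combine by Euler's reflection
formula to the Gamma product in g_m, and the inverted series acquires the coefficients ∑ cos(πp(k +
j)/m). `pairSum_cos` evaluates these: even p and the corrections at multiples of m and 2m give K_m,
while odd p give L_m. This proves the identity for real τ > 0. Both sides are holomorphic in Re τ >
0, so the identity theorem extends it (`bppGF_exp_neg`). -/

noncomputable section

/-! ### Interlacing partitions and the skew Cauchy identity -/

section

open scoped ENNReal
open Finset

/-- Integer partitions as weakly decreasing finitely supported sequences. -/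
abbrev Ptn : Type := {mu : ℕ →₀ ℕ // Antitone mu}

namespace Ptn

/-- The size of a partition. -/
def size (mu : Ptn) : ℕ := mu.1.sum fun _ a => a

theorem exists_bound (mu : Ptn) : ∃ N, ∀ i, N ≤ i → mu.1 i = 0 := by
  obtain ⟨N, hN⟩ := mu.1.support.exists_nat_subset_range
  refine ⟨N, fun i hi => ?_⟩
  by_contra h
  have := hN (Finsupp.mem_support_iff.2 h)
  rw [Finset.mem_range] at this
  omega

theorem size_eq_sum_range (mu : Ptn) {N : ℕ} (hN : ∀ i, N ≤ i → mu.1 i = 0) :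
    mu.size = ∑ i ∈ range N, mu.1 i := by
  refine Finsupp.sum_of_support_subset _ (fun i hi => ?_) _ (fun _ _ => rfl)
  rw [Finset.mem_range]
  by_contra h
  exact Finsupp.mem_support_iff.1 hi (hN i (not_lt.1 h))

/-- A partition from a sequence that is eventually zero. -/
def mk (g : ℕ → ℕ) (hg : ∀ i, g (i + 1) ≤ g i) (hN : ∃ N, ∀ i, N ≤ i → g i = 0) : Ptn :=
  ⟨Finsupp.ofSupportFinite g (by
    obtain ⟨N, hN⟩ := hN
    refine (Set.finite_lt_nat N).subset fun i hi => ?_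
    by_contra h
    exact hi (hN i (not_lt.1 h))), antitone_nat_of_succ_le hg⟩

@[simp] theorem mk_apply (g : ℕ → ℕ) (hg hN) (i : ℕ) : (mk g hg hN).1 i = g i := rfl

theorem ext_apply {mu nu : Ptn} (h : ∀ i, mu.1 i = nu.1 i) : mu = nu :=
  Subtype.ext (Finsupp.ext h)

/-- `la / mu` is a horizontal strip. -/
def Interlaces (la mu : Ptn) : Prop := ∀ i, mu.1 i ≤ la.1 i ∧ la.1 (i + 1) ≤ mu.1 i

theorem Interlaces.refl (mu : Ptn) : Interlaces mu mu :=
  fun i => ⟨le_rfl, mu.2 (Nat.le_succ i)⟩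

theorem Interlaces.size_le {la mu : Ptn} (h : Interlaces la mu) : mu.size ≤ la.size := by
  obtain ⟨N, hN⟩ := la.exists_bound
  have hN' : ∀ i, N ≤ i → mu.1 i = 0 := fun i hi => Nat.le_zero.1 ((h i).1.trans (hN i hi).le)
  rw [size_eq_sum_range _ hN, size_eq_sum_range _ hN']
  exact Finset.sum_le_sum fun i _ => (h i).1

theorem Interlaces.size_lt {la mu : Ptn} (h : Interlaces la mu) (hne : la ≠ mu) :
    mu.size < la.size := by
  obtain ⟨N, hN⟩ := la.exists_bound
  have hN' : ∀ i, N ≤ i → mu.1 i = 0 := fun i hi => Nat.le_zero.1 ((h i).1.trans (hN i hi).le)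
  rw [size_eq_sum_range _ hN, size_eq_sum_range _ hN']
  refine lt_of_le_of_ne (Finset.sum_le_sum fun i _ => (h i).1) fun heq => hne (ext_apply fun i => ?_)
  rcases lt_or_ge i N with hi | hi
  · exact ((Finset.sum_eq_sum_iff_of_le fun i _ => (h i).1).1 heq i (Finset.mem_range.2 hi)).symm
  · rw [hN i hi, hN' i hi]

/-- The sequence `g` preceded by `a`. -/
def consSeq (a : ℕ) (g : ℕ → ℕ) : ℕ → ℕ
  | 0 => a
  | i + 1 => g i

@[simp] theorem consSeq_zero (a : ℕ) (g : ℕ → ℕ) : consSeq a g 0 = a := rfl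

@[simp] theorem consSeq_succ (a : ℕ) (g : ℕ → ℕ) (i : ℕ) : consSeq a g (i + 1) = g i := rfl

/-- The reflection of the rows of `la` in the intervals in which they are confined by `mu` and
`nu`. -/
def reflect (mu nu : Ptn) : {la : Ptn // la.Interlaces mu ∧ la.Interlaces nu} ≃
    ℕ × {ka : Ptn // mu.Interlaces ka ∧ nu.Interlaces ka} where
  -- Row `i + 1` of `la` and row `i` of the image are confined to the same interval, from the larger
  -- of the rows `i + 1` of `mu`, `nu` to the smaller of their rows `i`; reflection in its midpoint
  -- exchanges them. The top row of `la` has no upper bound, and its excess is the free natural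
  -- number.
  toFun la := (la.1.1 0 - max (mu.1 0) (nu.1 0),
    ⟨mk (fun i => max (mu.1 (i + 1)) (nu.1 (i + 1)) + min (mu.1 i) (nu.1 i) - la.1.1 (i + 1))
      (fun i => by
        have h0 := la.2.1 i
        have h1 := la.2.1 (i + 1)
        have h2 := la.2.2 (i + 1)
        have h3 := la.2.1 (i + 1 + 1)
        have h4 := la.2.2 (i + 1 + 1)
        have h5 := la.2.2 i
        omega)
      (by
        obtain ⟨N, hN⟩ := mu.exists_bound
        refine ⟨N, fun i hi => ?_⟩
        have h0 := hN i hi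
        have h2 := la.2.1 (i + 1)
        have h3 := la.2.2 (i + 1)
        omega),
      fun i => by
        have h0 := la.2.1 i
        have h1 := la.2.1 (i + 1)
        have h2 := la.2.2 (i + 1)
        have h5 := la.2.2 i
        simp only [mk_apply]
        omega,
      fun i => by
        have h0 := la.2.1 i
        have h1 := la.2.1 (i + 1)
        have h2 := la.2.2 (i + 1)
        have h5 := la.2.2 i
        simp only [mk_apply]
        omega⟩)
  invFun p := ⟨mk (consSeq (p.1 + max (mu.1 0) (nu.1 0)) fun i =>
      max (mu.1 (i + 1)) (nu.1 (i + 1)) + min (mu.1 i) (nu.1 i) - p.2.1.1 i)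
      (fun i => by
        cases i with
        | zero =>
          have h0 := p.2.2.1 0
          have h1 := p.2.2.2 0
          simp only [consSeq_zero, consSeq_succ]
          omega
        | succ i =>
          have h0 := p.2.2.1 i
          have h1 := p.2.2.2 i
          have h2 := p.2.2.1 (i + 1)
          have h3 := p.2.2.2 (i + 1)
          simp only [consSeq_succ]
          omega)
      (by
        obtain ⟨N, hN⟩ := mu.exists_bound
        obtain ⟨N', hN'⟩ := nu.exists_bound
        refine ⟨N + N' + 1, fun i hi => ?_⟩
        cases i with
        | zero => omega
        | succ i =>
          have h0 := hN i (by omega)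
          have h1 := hN (i + 1) (by omega)
          have h2 := hN' (i + 1) (by omega)
          simp only [consSeq_succ]
          omega),
      fun i => by
        have h0 := p.2.2.1 i
        have h1 := p.2.2.2 i
        cases i with
        | zero =>
          simp only [mk_apply, consSeq_zero, consSeq_succ]
          omega
        | succ i =>
          have h2 := p.2.2.1 i
          have h3 := p.2.2.2 i
          simp only [mk_apply, consSeq_succ]
          omega,
      fun i => by
        have h0 := p.2.2.1 i
        have h1 := p.2.2.2 i
        cases i with
        | zero =>
          simp only [mk_apply, consSeq_zero, consSeq_succ]
          omega
        | succ i =>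
          have h2 := p.2.2.1 i
          have h3 := p.2.2.2 i
          simp only [mk_apply, consSeq_succ]
          omega⟩
  left_inv la := by
    refine Subtype.ext (ext_apply fun i => ?_)
    cases i with
    | zero =>
      have h0 := la.2.1 0
      have h1 := la.2.2 0
      simp only [mk_apply, consSeq_zero]
      omega
    | succ i =>
      have h0 := la.2.1 i
      have h1 := la.2.2 i
      have h2 := la.2.1 (i + 1)
      have h3 := la.2.2 (i + 1)
      simp only [mk_apply, consSeq_succ]
      omega
  right_inv p := by
    refine Prod.ext ?_ (Subtype.ext (ext_apply fun i => ?_))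
    · simp
    · have h0 := p.2.2.1 i
      have h1 := p.2.2.2 i
      simp only [mk_apply, consSeq_succ]
      omega

/-- A row and its reflection add up to the two endpoints of their interval, and a maximum and a
minimum add up to the two numbers themselves. -/
theorem size_reflect (mu nu : Ptn) (la : {la : Ptn // la.Interlaces mu ∧ la.Interlaces nu}) :
    la.1.size + (reflect mu nu la).2.1.size = (reflect mu nu la).1 + mu.size + nu.size := by
  obtain ⟨N1, h1⟩ := mu.exists_bound
  obtain ⟨N2, h2⟩ := nu.exists_bound
  set N := N1 + N2 with hN
  have hmu : ∀ i, N + 1 ≤ i → mu.1 i = 0 := fun i hi => h1 i (by omega)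
  have hnu : ∀ i, N + 1 ≤ i → nu.1 i = 0 := fun i hi => h2 i (by omega)
  have hla : ∀ i, N + 1 ≤ i → la.1.1 i = 0 := fun i hi => by
    obtain ⟨i, rfl⟩ : ∃ k, i = k + 1 := ⟨i - 1, by omega⟩
    have := (la.2.1 i).2
    have := h1 i (by omega)
    omega
  have hka : ∀ i, N ≤ i → (reflect mu nu la).2.1.1 i = 0 := fun i hi => by
    have := ((reflect mu nu la).2.2.1 i).1
    have := h1 i (by omega)
    omega
  rw [size_eq_sum_range _ hmu, size_eq_sum_range _ hnu, size_eq_sum_range _ hla,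
    size_eq_sum_range _ hka, Finset.sum_range_succ', add_right_comm, ← Finset.sum_add_distrib]
  have key : ∀ i ∈ range N, la.1.1 (i + 1) + (reflect mu nu la).2.1.1 i =
      max (mu.1 (i + 1)) (nu.1 (i + 1)) + min (mu.1 i) (nu.1 i) := by
    intro i _
    have h0 := la.2.1 (i + 1)
    have h1 := la.2.2 (i + 1)
    have h3 := la.2.1 i
    have h4 := la.2.2 i
    simp only [reflect, Equiv.coe_fn_mk, mk_apply]
    omega
  have h0 : la.1.1 0 = (reflect mu nu la).1 + max (mu.1 0) (nu.1 0) := by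
    have h0 := la.2.1 0
    have h1 := la.2.2 0
    simp only [reflect, Equiv.coe_fn_mk]
    omega
  have hmax : max (mu.1 0) (nu.1 0) + ∑ i ∈ range N, max (mu.1 (i + 1)) (nu.1 (i + 1)) =
      ∑ i ∈ range (N + 1), max (mu.1 i) (nu.1 i) := by
    rw [Finset.sum_range_succ', add_comm]
  have hmin : ∑ i ∈ range N, min (mu.1 i) (nu.1 i) =
      ∑ i ∈ range (N + 1), min (mu.1 i) (nu.1 i) := by
    rw [Finset.sum_range_succ, h1 N (by omega)]
    simp
  have hmm : ∑ i ∈ range (N + 1), max (mu.1 i) (nu.1 i) +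
      ∑ i ∈ range (N + 1), min (mu.1 i) (nu.1 i) =
      ∑ i ∈ range (N + 1), mu.1 i + ∑ i ∈ range (N + 1), nu.1 i := by
    rw [← Finset.sum_add_distrib, ← Finset.sum_add_distrib]
    exact Finset.sum_congr rfl fun i _ => max_add_min _ _
  rw [Finset.sum_congr rfl key, Finset.sum_add_distrib]
  omega

open Classical in
/-- The weight of a horizontal strip. -/
def stripWeight (x : ℝ≥0∞) (la mu : Ptn) : ℝ≥0∞ :=
  if la.Interlaces mu then x ^ (la.size - mu.size) else 0

/-- Skew Cauchy identity for one-variable strips. Under `reflect` both exponents grow by the excess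
`k` of the top row, and the geometric series in `k` is the prefactor; it is valid for all `x`, `y`
because the sums are in `ℝ≥0∞`. -/
theorem tsum_stripWeight_mul_stripWeight (x y : ℝ≥0∞) (mu nu : Ptn) :
    ∑' la, stripWeight x la mu * stripWeight y la nu =
      (1 - x * y)⁻¹ * ∑' ka, stripWeight x nu ka * stripWeight y mu ka := by
  classical
  have h1 : ∑' la, stripWeight x la mu * stripWeight y la nu =
      ∑' la : {la : Ptn // la.Interlaces mu ∧ la.Interlaces nu},
        x ^ (la.1.size - mu.size) * y ^ (la.1.size - nu.size) := by
    refine Eq.trans ?_ (tsum_subtype {la : Ptn | la.Interlaces mu ∧ la.Interlaces nu} fun la =>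
        x ^ (la.size - mu.size) * y ^ (la.size - nu.size)).symm
    refine tsum_congr fun la => ?_
    simp only [stripWeight, Set.indicator, Set.mem_ofPred_eq, ite_and]
    split_ifs <;> simp
  have h2 : ∑' ka, stripWeight x nu ka * stripWeight y mu ka =
      ∑' ka : {ka : Ptn // mu.Interlaces ka ∧ nu.Interlaces ka},
        x ^ (nu.size - ka.1.size) * y ^ (mu.size - ka.1.size) := by
    refine Eq.trans ?_ (tsum_subtype {ka : Ptn | mu.Interlaces ka ∧ nu.Interlaces ka} fun ka =>
        x ^ (nu.size - ka.size) * y ^ (mu.size - ka.size)).symm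
    refine tsum_congr fun la => ?_
    simp only [stripWeight, Set.indicator, Set.mem_ofPred_eq, ite_and]
    split_ifs <;> simp
  rw [h1, h2, ← ENNReal.tsum_geometric, ← (reflect mu nu).symm.tsum_eq, ENNReal.tsum_prod
      (f := fun k ka => x ^ (((reflect mu nu).symm (k, ka)).1.size - mu.size) *
        y ^ (((reflect mu nu).symm (k, ka)).1.size - nu.size)),
    ← ENNReal.tsum_mul_right]
  refine tsum_congr fun k => ?_
  rw [← ENNReal.tsum_mul_left]
  refine tsum_congr fun ka => ?_
  have hs := size_reflect mu nu ((reflect mu nu).symm (k, ka))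
  rw [Equiv.apply_symm_apply] at hs
  have h3 := ka.2.1.size_le
  have h4 := ka.2.2.size_le
  simp only at hs
  have e1 : ((reflect mu nu).symm (k, ka)).1.size - mu.size = k + (nu.size - ka.1.size) := by omega
  have e2 : ((reflect mu nu).symm (k, ka)).1.size - nu.size = k + (mu.size - ka.1.size) := by omega
  rw [e1, e2, pow_add, pow_add, mul_pow]
  ring

theorem stripWeight_mul_stripWeight_one (x : ℝ≥0∞) (la mu : Ptn) :
    stripWeight x la mu * stripWeight 1 la mu = stripWeight x la mu := by
  simp only [stripWeight]
  split_ifs <;> simp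

/-- The Cauchy identity with `mu = nu` and `y = 1`, where the second weight is only the indicator of
interlacing, already contained in the first. -/
theorem tsum_stripWeight (x : ℝ≥0∞) (mu : Ptn) :
    ∑' la, stripWeight x la mu = (1 - x)⁻¹ * ∑' ka, stripWeight x mu ka := by
  have h := tsum_stripWeight_mul_stripWeight x 1 mu mu
  simpa only [stripWeight_mul_stripWeight_one, mul_one] using h

/-! ### Strip operators and reflection at a free boundary -/

/-- The operator that adds a horizontal strip. -/
def addStrip (x : ℝ≥0∞) (f : Ptn → ℝ≥0∞) (mu : Ptn) : ℝ≥0∞ :=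
  ∑' la, stripWeight x la mu * f la

/-- The operator that removes a horizontal strip. -/
def removeStrip (x : ℝ≥0∞) (f : Ptn → ℝ≥0∞) (la : Ptn) : ℝ≥0∞ :=
  ∑' mu, stripWeight x la mu * f mu

theorem addStrip_one (x : ℝ≥0∞) : addStrip x 1 = (1 - x)⁻¹ • removeStrip x 1 := by
  ext mu
  simpa [addStrip, removeStrip] using tsum_stripWeight x mu

theorem addStrip_removeStrip (x y : ℝ≥0∞) (f : Ptn → ℝ≥0∞) :
    addStrip x (removeStrip y f) = (1 - x * y)⁻¹ • removeStrip y (addStrip x f) := by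
  ext mu
  simp only [addStrip, removeStrip, Pi.smul_apply, smul_eq_mul, ← ENNReal.tsum_mul_left]
  rw [ENNReal.tsum_comm]
  conv_rhs => rw [ENNReal.tsum_comm]
  refine tsum_congr fun nu => ?_
  have h := tsum_stripWeight_mul_stripWeight x y mu nu
  simp only [← mul_assoc, ENNReal.tsum_mul_right]
  rw [h, ← ENNReal.tsum_mul_left]
  congr 1
  exact tsum_congr fun _ => by ring

theorem addStrip_smul (x c : ℝ≥0∞) (f : Ptn → ℝ≥0∞) : addStrip x (c • f) = c • addStrip x f := by
  ext mu
  simp only [addStrip, Pi.smul_apply, smul_eq_mul, ← ENNReal.tsum_mul_left]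
  exact tsum_congr fun _ => by ring

theorem removeStrip_smul (x c : ℝ≥0∞) (f : Ptn → ℝ≥0∞) :
    removeStrip x (c • f) = c • removeStrip x f := by
  ext mu
  simp only [removeStrip, Pi.smul_apply, smul_eq_mul, ← ENNReal.tsum_mul_left]
  exact tsum_congr fun _ => by ring

/-- Adding and removing strips are transposes of each other. -/
theorem tsum_mul_removeStrip (x : ℝ≥0∞) (f g : Ptn → ℝ≥0∞) :
    ∑' la, f la * removeStrip x g la = ∑' mu, addStrip x f mu * g mu := by
  simp only [addStrip, removeStrip, ← ENNReal.tsum_mul_left, ← ENNReal.tsum_mul_right]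
  rw [ENNReal.tsum_comm]
  exact tsum_congr fun _ => tsum_congr fun _ => by ring

/-- Successive addition of strips. -/
def addStrips : List ℝ≥0∞ → (Ptn → ℝ≥0∞) → Ptn → ℝ≥0∞
  | [], f => f
  | x :: L, f => addStrips L (addStrip x f)

/-- Successive removal of strips, in the opposite order. -/
def removeStrips : List ℝ≥0∞ → (Ptn → ℝ≥0∞) → Ptn → ℝ≥0∞
  | [], f => f
  | x :: L, f => removeStrip x (removeStrips L f)

theorem addStrips_smul (L : List ℝ≥0∞) (c : ℝ≥0∞) (f : Ptn → ℝ≥0∞) :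
    addStrips L (c • f) = c • addStrips L f := by
  induction L generalizing f with
  | nil => rfl
  | cons x L ih => rw [addStrips, addStrip_smul, ih, addStrips]

theorem addStrips_append (L : List ℝ≥0∞) (x : ℝ≥0∞) (f : Ptn → ℝ≥0∞) :
    addStrips (L ++ [x]) f = addStrip x (addStrips L f) := by
  induction L generalizing f with
  | nil => rfl
  | cons y L ih => exact ih _

/-- The factor `∏ (1 - xᵢ)⁻¹ ∏_{i < j} (1 - xᵢ xⱼ)⁻¹`. -/
def reflectFactor : List ℝ≥0∞ → ℝ≥0∞
  | [] => 1
  | x :: L => (1 - x)⁻¹ * (L.map fun y => (1 - x * y)⁻¹).prod * reflectFactor L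

theorem addStrips_removeStrip (L : List ℝ≥0∞) (x : ℝ≥0∞) (f : Ptn → ℝ≥0∞) :
    addStrips L (removeStrip x f) =
      (L.map fun y => (1 - x * y)⁻¹).prod • removeStrip x (addStrips L f) := by
  induction L generalizing f with
  | nil => simp [addStrips]
  | cons y L ih =>
    rw [addStrips, addStrip_removeStrip, addStrips_smul, ih, smul_smul, List.map_cons,
      List.prod_cons, addStrips, mul_comm y x]

/-- The strip nearest to the free boundary is reflected there and then commuted past the remaining
ones. The reflections give the factors (1 - xᵢ)⁻¹, the commutations the factors (1 - xᵢxⱼ)⁻¹. -/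
theorem addStrips_one (L : List ℝ≥0∞) : addStrips L 1 = reflectFactor L • removeStrips L 1 := by
  induction L with
  | nil => simp [addStrips, removeStrips, reflectFactor]
  | cons x L ih =>
    rw [addStrips, addStrip_one, addStrips_smul, addStrips_removeStrip, ih, removeStrip_smul,
      smul_smul, smul_smul, reflectFactor, removeStrips, mul_assoc]

theorem tsum_mul_removeStrips (L : List ℝ≥0∞) (f g : Ptn → ℝ≥0∞) :
    ∑' la, f la * removeStrips L g la = ∑' mu, addStrips L f mu * g mu := by
  induction L generalizing f with
  | nil => rfl
  | cons x L ih => rw [removeStrips, tsum_mul_removeStrip, ih, addStrips]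

/-- The function `u ^ |mu|`. -/
def sizePow (u : ℝ≥0∞) (mu : Ptn) : ℝ≥0∞ := u ^ mu.size

/-- The power of `u` splits along the strip: its cells change the parameter to `u * x`, and the
smaller partition keeps its own power. -/
theorem sizePow_mul_removeStrip (u x : ℝ≥0∞) (f : Ptn → ℝ≥0∞) :
    sizePow u * removeStrip x f = removeStrip (u * x) (sizePow u * f) := by
  ext la
  simp only [removeStrip, Pi.mul_apply, ← ENNReal.tsum_mul_left, stripWeight, sizePow]
  refine tsum_congr fun mu => ?_
  split_ifs with h
  · obtain ⟨k, hk⟩ := Nat.exists_eq_add_of_le h.size_le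
    rw [hk, Nat.add_sub_cancel_left, pow_add, mul_pow]
    ring
  · simp

theorem sizePow_mul_removeStrips (u : ℝ≥0∞) (L : List ℝ≥0∞) (f : Ptn → ℝ≥0∞) :
    sizePow u * removeStrips L f = removeStrips (L.map (u * ·)) (sizePow u * f) := by
  induction L with
  | nil => rfl
  | cons x L ih => rw [removeStrips, sizePow_mul_removeStrip, ih, List.map_cons, removeStrips]

/-! ### Two free boundaries: iteration and limit -/

/-- The partition function with free boundary on both sides. -/
def freeBoundarySum (u : ℝ≥0∞) (L : List ℝ≥0∞) : ℝ≥0∞ := ∑' mu, sizePow u mu * addStrips L 1 mu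

/-- One round trip: all strips are reflected at one boundary, carried through the weight `u ^ |mu|`,
which multiplies their parameters by `u`, and transposed back into strips to be added. -/
theorem freeBoundarySum_eq_mul (u : ℝ≥0∞) (L : List ℝ≥0∞) :
    freeBoundarySum u L = reflectFactor L * freeBoundarySum u (L.map (u * ·)) := by
  have h := tsum_mul_removeStrips (L.map (u * ·)) 1 (sizePow u * 1)
  rw [← sizePow_mul_removeStrips] at h
  simp only [Pi.mul_apply, Pi.one_apply, one_mul, mul_one] at h
  simp only [freeBoundarySum]
  rw [addStrips_one]
  simp only [Pi.smul_apply, smul_eq_mul, mul_left_comm _ (reflectFactor L), ENNReal.tsum_mul_left]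
  rw [h]
  congr 1
  exact tsum_congr fun _ => mul_comm _ _

theorem addStrip_mono (x : ℝ≥0∞) {f g : Ptn → ℝ≥0∞} (h : f ≤ g) : addStrip x f ≤ addStrip x g :=
  fun _ => ENNReal.tsum_le_tsum fun la => mul_le_mul_right (h la) _

theorem addStrips_mono (L : List ℝ≥0∞) {f g : Ptn → ℝ≥0∞} (h : f ≤ g) :
    addStrips L f ≤ addStrips L g := by
  induction L generalizing f g with
  | nil => exact h
  | cons x L ih => exact ih (addStrip_mono x h)

theorem le_addStrip (x : ℝ≥0∞) (f : Ptn → ℝ≥0∞) : f ≤ addStrip x f := by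
  intro mu
  refine le_trans ?_ (ENNReal.le_tsum mu)
  simp [stripWeight, Interlaces.refl]

theorem le_addStrips (L : List ℝ≥0∞) (f : Ptn → ℝ≥0∞) : f ≤ addStrips L f := by
  induction L generalizing f with
  | nil => exact le_rfl
  | cons x L ih => exact (le_addStrip x f).trans (ih _)

/-- The empty strip gives `f`. Every other strip has at least one cell, hence a factor at most `y`
when `y ≤ 1`. -/
theorem addStrip_mul_le {y : ℝ≥0∞} (hy : y ≤ 1) (x : ℝ≥0∞) (f : Ptn → ℝ≥0∞) :
    addStrip (y * x) f ≤ f + y • addStrip x f := by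
  classical
  intro mu
  have h1 : ∑' la, (if la = mu then f la else 0) = f mu := by
    rw [tsum_eq_single mu fun b hb => if_neg hb, if_pos rfl]
  simp only [addStrip, Pi.add_apply, Pi.smul_apply, smul_eq_mul]
  rw [← h1, ← ENNReal.tsum_mul_left, ← ENNReal.tsum_add]
  refine ENNReal.tsum_le_tsum fun la => ?_
  by_cases hla : la = mu
  · subst hla
    rw [if_pos rfl]
    refine le_trans ?_ le_self_add
    simp [stripWeight, Interlaces.refl]
  · rw [if_neg hla, zero_add, ← mul_assoc]
    refine mul_le_mul_left ?_ _
    simp only [stripWeight]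
    split_ifs with h
    · rw [mul_pow]
      exact mul_le_mul_left (by simpa using pow_le_pow_right_of_le_one' hy (Nat.sub_pos_of_lt (h.size_lt hla))) _
    · simp

theorem addStrips_mul_le {y : ℝ≥0∞} (hy : y ≤ 1) (L : List ℝ≥0∞) (f : Ptn → ℝ≥0∞) :
    addStrips (L.map (y * ·)) f ≤ f + (L.length * y) • addStrips L f := by
  induction L generalizing f with
  | nil => simp [addStrips]
  | cons x L ih =>
    rw [List.map_cons, addStrips, addStrips]
    refine (ih _).trans ?_
    have h1 := addStrip_mul_le hy x f
    have h2 : addStrip (y * x) f ≤ addStrip x f := by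
      refine fun mu => ENNReal.tsum_le_tsum fun la => mul_le_mul_left ?_ _
      simp only [stripWeight]
      split_ifs
      · exact pow_le_pow_left' (mul_le_of_le_one_left' hy) _
      · exact le_rfl
    intro mu
    have h3 := addStrips_mono L h2 mu
    have h4 := le_addStrips L (addStrip x f) mu
    have h5 := h1 mu
    simp only [Pi.add_apply, Pi.smul_apply, smul_eq_mul, List.length_cons, Nat.cast_add,
      Nat.cast_one] at *
    calc _ ≤ (f mu + y * addStrips L (addStrip x f) mu) +
          L.length * y * addStrips L (addStrip x f) mu := by gcongr; exact h5.trans (by gcongr)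
      _ = _ := by ring

/-- Shows that the remainder after many rounds is close to the sum without strips, with an error
linear in the scaling factor of the parameters. -/
theorem freeBoundarySum_mul_le {y : ℝ≥0∞} (hy : y ≤ 1) (u : ℝ≥0∞) (L : List ℝ≥0∞) :
    freeBoundarySum u (L.map (y * ·)) ≤
      ∑' mu, sizePow u mu + L.length * y * freeBoundarySum u L := by
  simp only [freeBoundarySum]
  rw [← ENNReal.tsum_mul_left, ← ENNReal.tsum_add]
  refine ENNReal.tsum_le_tsum fun mu => ?_
  have h := addStrips_mul_le hy L 1 mu
  simp only [Pi.add_apply, Pi.smul_apply, smul_eq_mul, Pi.one_apply] at h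
  calc _ ≤ sizePow u mu * (1 + L.length * y * addStrips L 1 mu) := by gcongr
    _ = _ := by ring

theorem le_freeBoundarySum (u : ℝ≥0∞) (L : List ℝ≥0∞) :
    ∑' mu, sizePow u mu ≤ freeBoundarySum u L := by
  refine ENNReal.tsum_le_tsum fun mu => ?_
  exact le_mul_of_one_le_right' (le_addStrips L 1 mu)

theorem freeBoundarySum_eq_prod_mul (u : ℝ≥0∞) (L : List ℝ≥0∞) (n : ℕ) :
    freeBoundarySum u L = (∏ i ∈ range n, reflectFactor (L.map (u ^ i * ·))) *
      freeBoundarySum u (L.map (u ^ n * ·)) := by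
  induction n with
  | zero => simp
  | succ n ih =>
    rw [ih, Finset.prod_range_succ, freeBoundarySum_eq_mul u (L.map (u ^ n * ·)), List.map_map,
      mul_assoc]
    congr 4
    ext x
    simp only [Function.comp_apply, pow_succ]
    ring

open Filter Topology in
-- After `n` rounds the remaining free boundary sum lies between the sum over single partitions and
-- that sum plus a multiple of `u ^ n`. Finiteness of the total makes the error vanish.
theorem tendsto_prod_reflectFactor {u : ℝ≥0∞} (hu : u < 1) (L : List ℝ≥0∞)
    (hfin : freeBoundarySum u L ≠ ∞) :
    Tendsto (fun n => (∏ i ∈ range n, reflectFactor (L.map (u ^ i * ·))) * ∑' mu, sizePow u mu)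
      atTop (𝓝 (freeBoundarySum u L)) := by
  have hpow : Tendsto (fun n : ℕ => u ^ n) atTop (𝓝 0) :=
    ENNReal.tendsto_pow_atTop_nhds_zero_of_lt_one hu
  set Z := freeBoundarySum u L
  have h1 : ∀ n, (∏ i ∈ range n, reflectFactor (L.map (u ^ i * ·))) * ∑' mu, sizePow u mu ≤ Z :=
    fun n => by
      rw [show Z = _ from freeBoundarySum_eq_prod_mul u L n]
      gcongr
      exact le_freeBoundarySum _ _
  -- The empty partition alone contributes 1, so the finite products are bounded by `Z` as well.
  have hP1 : 1 ≤ ∑' mu, sizePow u mu := by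
    refine le_trans ?_ (ENNReal.le_tsum (⟨0, fun _ _ _ => le_rfl⟩ : Ptn))
    simp [sizePow, size]
  have hprod : ∀ n, ∏ i ∈ range n, reflectFactor (L.map (u ^ i * ·)) ≤ Z := fun n =>
    (le_mul_of_one_le_right' hP1).trans (h1 n)
  have h2 : ∀ n, Z ≤ (∏ i ∈ range n, reflectFactor (L.map (u ^ i * ·))) * ∑' mu, sizePow u mu +
      Z * (L.length * u ^ n * Z) := fun n => by
    calc Z = _ := freeBoundarySum_eq_prod_mul u L n
      _ ≤ (∏ i ∈ range n, reflectFactor (L.map (u ^ i * ·))) * (∑' mu, sizePow u mu +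
          L.length * u ^ n * Z) := by
        gcongr
        exact freeBoundarySum_mul_le (pow_le_one' hu.le n) u L
      _ ≤ _ := by
        rw [mul_add]
        gcongr
        exact hprod n
  have h3 : Tendsto (fun n => Z * (L.length * u ^ n * Z)) atTop (𝓝 0) := by
    have : Tendsto (fun n => (Z * L.length * Z) * u ^ n) atTop (𝓝 ((Z * L.length * Z) * 0)) :=
      ENNReal.Tendsto.const_mul hpow (Or.inr (ENNReal.mul_ne_top
        (ENNReal.mul_ne_top hfin (ENNReal.natCast_ne_top _)) hfin))
    rw [mul_zero] at this
    exact this.congr fun n => by ring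
  refine tendsto_of_tendsto_of_tendsto_of_le_of_le (g := fun n => Z - Z * (L.length * u ^ n * Z))
    (h := fun _ => Z) ?_ tendsto_const_nhds (fun n => ?_) h1
  · have := ENNReal.Tendsto.sub (tendsto_const_nhds (x := Z)) h3 (Or.inl hfin)
    rwa [tsub_zero] at this
  · exact tsub_le_iff_right.2 (h2 n)

end Ptn

end

/-! ### Euler's product and chains of partitions -/

section

open scoped ENNReal
open Finset

namespace Ptn

theorem apply_eq_zero_of_le {mu : Ptn} {n i : ℕ} (h : mu.1 n = 0) (hi : n ≤ i) : mu.1 i = 0 :=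
  Nat.le_zero.1 ((mu.2 hi).trans h.le)

/-- Partitions with at most `n + 1` parts, by the smallest part and the differences to it. -/
def addColumns (n : ℕ) : ℕ × {nu : Ptn // nu.1 n = 0} ≃ {mu : Ptn // mu.1 (n + 1) = 0} where
  toFun p := ⟨mk (fun i => p.2.1.1 i + if i ≤ n then p.1 else 0)
    (fun i => by
      have := p.2.1.2 (Nat.le_add_right i 1)
      split_ifs <;> omega)
    ⟨n + 1, fun i hi => by
      rw [apply_eq_zero_of_le p.2.2 (by omega : n ≤ i), if_neg (by omega)]⟩, by
      simp [apply_eq_zero_of_le p.2.2 (Nat.le_succ n)]⟩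
  invFun mu := (mu.1.1 n, ⟨mk (fun i => mu.1.1 i - mu.1.1 n)
    (fun i => by
      have := mu.1.2 (Nat.le_add_right i 1)
      omega)
    ⟨n, fun i hi => by
      have := mu.1.2 hi
      omega⟩, by simp⟩)
  left_inv p := by
    refine Prod.ext ?_ (Subtype.ext (ext_apply fun i => ?_))
    · simp [p.2.2]
    · have h : n < i → p.2.1.1 i = 0 := fun hi => apply_eq_zero_of_le p.2.2 hi.le
      simp only [mk_apply, p.2.2, le_refl, if_true]
      split_ifs <;> omega
  right_inv mu := by
    refine Subtype.ext (ext_apply fun i => ?_)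
    have h : n < i → mu.1.1 i = 0 := fun hi => apply_eq_zero_of_le mu.2 hi
    have h' : i ≤ n → mu.1.1 n ≤ mu.1.1 i := fun hi => mu.1.2 hi
    simp only [mk_apply]
    split_ifs <;> omega

theorem size_addColumns (n k : ℕ) (nu : {nu : Ptn // nu.1 n = 0}) :
    (addColumns n (k, nu)).1.size = (n + 1) * k + nu.1.size := by
  rw [size_eq_sum_range (N := n + 1) _ fun i hi => apply_eq_zero_of_le (addColumns n (k, nu)).2 hi,
    size_eq_sum_range (N := n + 1) _ fun i hi => apply_eq_zero_of_le nu.2 (by omega : n ≤ i)]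
  have : ∀ i ∈ range (n + 1), (addColumns n (k, nu)).1.1 i = k + nu.1.1 i := fun i hi => by
    have : i ≤ n := by
      have := Finset.mem_range.1 hi
      omega
    simp [addColumns, this, add_comm]
  rw [Finset.sum_congr rfl this, Finset.sum_add_distrib]
  simp

theorem tsum_sizePow_of_apply_eq_zero (u : ℝ≥0∞) (n : ℕ) :
    ∑' mu : {mu : Ptn // mu.1 n = 0}, u ^ mu.1.size = ∏ i ∈ range n, (1 - u ^ (i + 1))⁻¹ := by
  induction n with
  | zero =>
    rw [tsum_eq_single ⟨⟨0, fun _ _ _ => le_rfl⟩, rfl⟩]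
    · simp [size]
    · intro mu hmu
      exact (hmu (Subtype.ext (ext_apply fun i => apply_eq_zero_of_le mu.2 (Nat.zero_le i)))).elim
  | succ n ih =>
    rw [Finset.prod_range_succ, ← ih, ← (addColumns n).tsum_eq, ENNReal.tsum_prod
      (f := fun k nu => u ^ (addColumns n (k, nu)).1.size), ← ENNReal.tsum_geometric,
      ← ENNReal.tsum_mul_left]
    refine tsum_congr fun k => ?_
    rw [mul_comm, ← ENNReal.tsum_mul_left]
    refine tsum_congr fun nu => ?_
    rw [size_addColumns, pow_add, pow_mul]

/-- Euler's product. A finite set of partitions has a common bound on the number of parts, so the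
full sum is the supremum of the sums with bounded number of parts. -/
theorem tsum_sizePow (u : ℝ≥0∞) :
    ∑' mu, sizePow u mu = ⨆ n : ℕ, ∏ i ∈ range n, (1 - u ^ (i + 1))⁻¹ := by
  refine le_antisymm ?_ (iSup_le fun n => ?_)
  · rw [ENNReal.tsum_eq_iSup_sum]
    refine iSup_le fun s => ?_
    choose N hN using exists_bound
    obtain ⟨M, hM⟩ := (s.image N).exists_le
    refine le_iSup_of_le M ?_
    rw [← tsum_sizePow_of_apply_eq_zero]
    have h : ∀ mu ∈ s, mu.1 M = 0 := fun mu hmu => hN mu M (hM _ (Finset.mem_image_of_mem N hmu))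
    rw [← Finset.sum_subtype_of_mem (p := fun mu : Ptn => mu.1 M = 0) (fun mu => sizePow u mu) h]
    exact ENNReal.sum_le_tsum _
  · rw [← tsum_sizePow_of_apply_eq_zero]
    exact ENNReal.tsum_comp_le_tsum_of_injective Subtype.val_injective _

/-- Chains of successively interlacing partitions. -/
def IsChain {n : ℕ} (c : Fin (n + 1) → Ptn) : Prop :=
  ∀ d : Fin n, (c d.castSucc).Interlaces (c d.succ)

open Classical in
/-- The weight of a sequence of partitions, zero unless the sequence is a chain. -/
def chainWeight (q : ℝ≥0∞) {n : ℕ} (c : Fin (n + 1) → Ptn) : ℝ≥0∞ :=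
  if IsChain c then q ^ ∑ d, (c d).size else 0

theorem isChain_snoc {n : ℕ} (c : Fin (n + 1) → Ptn) (mu : Ptn) :
    IsChain (Fin.snoc c mu : Fin (n + 2) → Ptn) ↔
      IsChain c ∧ (c (Fin.last n)).Interlaces mu := by
  constructor
  · intro h
    refine ⟨fun d => ?_, ?_⟩
    · have := h d.castSucc
      rwa [Fin.snoc_castSucc, Fin.succ_castSucc, Fin.snoc_castSucc] at this
    · have := h (Fin.last n)
      rwa [Fin.snoc_castSucc, Fin.succ_last, Fin.snoc_last] at this
  · rintro ⟨h1, h2⟩ d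
    induction d using Fin.lastCases with
    | last => rwa [Fin.snoc_castSucc, Fin.succ_last, Fin.snoc_last]
    | cast d =>
      rw [Fin.snoc_castSucc, Fin.succ_castSucc, Fin.snoc_castSucc]
      exact h1 d

theorem chainWeight_snoc (q : ℝ≥0∞) {n : ℕ} (c : Fin (n + 1) → Ptn) (mu : Ptn) :
    chainWeight q (Fin.snoc c mu : Fin (n + 2) → Ptn) =
      chainWeight q c * (stripWeight 1 (c (Fin.last n)) mu * q ^ mu.size) := by
  by_cases h : IsChain (Fin.snoc c mu : Fin (n + 2) → Ptn)
  · obtain ⟨h1, h2⟩ := (isChain_snoc c mu).1 h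
    rw [chainWeight, if_pos h, chainWeight, if_pos h1, stripWeight, if_pos h2, one_pow, one_mul,
      Fin.sum_univ_castSucc, pow_add, Fin.snoc_last]
    simp only [Fin.snoc_castSucc]
  · rw [chainWeight, if_neg h]
    rw [isChain_snoc, not_and_or] at h
    rcases h with h | h
    · rw [chainWeight, if_neg h, zero_mul]
    · rw [stripWeight, if_neg h, zero_mul, mul_zero]

theorem tsum_snoc {n : ℕ} (F : (Fin (n + 1) → Ptn) → ℝ≥0∞) :
    ∑' c, F c = ∑' c : Fin n → Ptn, ∑' mu : Ptn, F (Fin.snoc c mu : Fin (n + 1) → Ptn) := by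
  rw [← (Fin.snocEquiv fun _ => Ptn).tsum_eq, ENNReal.tsum_comm, ← ENNReal.tsum_prod]
  rfl

/-- The parameters `q, q ^ 2, …, q ^ n`. -/
def powList (q : ℝ≥0∞) (n : ℕ) : List ℝ≥0∞ := (List.range n).map fun i => q ^ (i + 1)

/-- A cell of the strip between members `d` and `d + 1` occurs in the members `0, …, d`, hence
carries `q ^ (d + 1)`; a cell of the last member occurs in all `n + 1`. The test function `g` of the
last member is what lets the induction append another one. -/
theorem tsum_chainWeight_mul (q : ℝ≥0∞) (n : ℕ) (g : Ptn → ℝ≥0∞) :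
    ∑' c : Fin (n + 1) → Ptn, chainWeight q c * g (c (Fin.last n)) =
      ∑' mu, sizePow (q ^ (n + 1)) mu * addStrips (powList q n) 1 mu * g mu := by
  induction n generalizing g with
  | zero =>
    rw [← (Equiv.funUnique (Fin 1) Ptn).symm.tsum_eq]
    refine tsum_congr fun mu => ?_
    have : IsChain ((Equiv.funUnique (Fin 1) Ptn).symm mu) := fun d => d.elim0
    rw [chainWeight, if_pos this]
    simp [powList, addStrips, sizePow, uniqueElim]
  | succ n ih =>
    rw [tsum_snoc]
    have h1 : ∀ c : Fin (n + 1) → Ptn, ∑' mu : Ptn,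
        chainWeight q (Fin.snoc c mu : Fin (n + 2) → Ptn) *
          g ((Fin.snoc c mu : Fin (n + 2) → Ptn) (Fin.last (n + 1))) =
        chainWeight q c *
          (fun la => ∑' mu, stripWeight 1 la mu * q ^ mu.size * g mu) (c (Fin.last n)) := by
      intro c
      rw [← ENNReal.tsum_mul_left]
      refine tsum_congr fun mu => ?_
      rw [chainWeight_snoc, Fin.snoc_last, mul_assoc]
    rw [tsum_congr h1, ih fun la => ∑' mu, stripWeight 1 la mu * q ^ mu.size * g mu]
    have h2 : powList q (n + 1) = powList q n ++ [q ^ (n + 1)] := by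
      simp [powList, List.range_succ]
    simp only [h2, addStrips_append, addStrip, ← ENNReal.tsum_mul_left, ← ENNReal.tsum_mul_right]
    rw [ENNReal.tsum_comm]
    refine tsum_congr fun mu => tsum_congr fun la => ?_
    simp only [sizePow, stripWeight]
    split_ifs with h
    · obtain ⟨k, hk⟩ := Nat.exists_eq_add_of_le h.size_le
      rw [hk, Nat.add_sub_cancel_left, pow_add (q ^ (n + 1)), pow_succ q (n + 1), mul_pow]
      ring
    · simp

theorem tsum_chainWeight (q : ℝ≥0∞) (n : ℕ) :
    ∑' c : Fin (n + 1) → Ptn, chainWeight q c = freeBoundarySum (q ^ (n + 1)) (powList q n) := by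
  simpa [freeBoundarySum] using tsum_chainWeight_mul q n 1

/-- Forgetting the interlacing leaves independent partitions. This crude bound serves only to show
that the free boundary sum is finite. -/
theorem tsum_chainWeight_le (q : ℝ≥0∞) (n : ℕ) :
    ∑' c : Fin (n + 1) → Ptn, chainWeight q c ≤ (∑' mu, sizePow q mu) ^ (n + 1) := by
  induction n with
  | zero =>
    rw [← (Equiv.funUnique (Fin 1) Ptn).symm.tsum_eq, zero_add, pow_one]
    refine ENNReal.tsum_le_tsum fun mu => ?_
    simp only [chainWeight]
    split_ifs <;> simp [sizePow]
  | succ n ih =>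
    rw [tsum_snoc, pow_succ, ← ENNReal.tsum_mul_left]
    refine le_trans ?_ (ENNReal.tsum_le_tsum fun mu => mul_le_mul_left ih _)
    simp only [← ENNReal.tsum_mul_right]
    rw [ENNReal.tsum_comm]
    refine ENNReal.tsum_le_tsum fun mu => ENNReal.tsum_le_tsum fun c => ?_
    rw [chainWeight_snoc]
    gcongr
    simp only [stripWeight]
    split_ifs <;> simp [sizePow]

end Ptn

/-! ### Diagonals of banded plane partitions -/

/-- The cells of the stair region by diagonal and row. -/
def stairEquiv (m : ℕ) : stairRegion m ≃ Fin m × ℕ where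
  toFun p := (⟨p.1.1 - p.1.2, by
    have := p.2.1
    have := p.2.2
    omega⟩, p.1.2)
  invFun p := ⟨(p.2 + p.1, p.2), by
    constructor <;> simp⟩
  left_inv p := by
    have := p.2.1
    ext <;> simp
    omega
  right_inv p := by
    ext <;> simp

/-- The diagonals of a finitely supported function on the stair region. -/
def diagonals (m : ℕ) : (stairRegion m →₀ ℕ) ≃ (Fin m → ℕ →₀ ℕ) :=
  ((Finsupp.equivCongrLeft (stairEquiv m)).trans Finsupp.curryEquiv).trans Finsupp.equivFunOnFinite

theorem diagonals_apply (m : ℕ) (f : stairRegion m →₀ ℕ) (d : Fin m) (j : ℕ) :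
    diagonals m f d j = f ((stairEquiv m).symm (d, j)) := by
  simp [diagonals, Finsupp.equivMapDomain_apply]

theorem apply_eq_diagonals (m : ℕ) (f : stairRegion m →₀ ℕ) (p : stairRegion m) :
    f p = diagonals m f (stairEquiv m p).1 (stairEquiv m p).2 := by
  rw [diagonals_apply, Prod.mk.eta, Equiv.symm_apply_apply]

theorem sum_diagonals (m : ℕ) (f : stairRegion m →₀ ℕ) :
    ∑ d, (diagonals m f d).sum (fun _ a => a) = f.sum fun _ a => a := by
  have h := Finsupp.sum_curry_index (Finsupp.equivMapDomain (stairEquiv m) f)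
    fun _ _ a => a
  rw [Finsupp.sum_equivMapDomain, Finsupp.sum_fintype _ _ (by simp)] at h
  exact h

/-- Entry `j` of diagonal `d` sits in the cell `(j + d, j)`. Raising the first coordinate leads to
the next diagonal at the same `j`; raising the second leads back to the previous diagonal at `j +
1`. -/
theorem isBandedPlanePartition_iff {n : ℕ} (f : stairRegion (n + 1) →₀ ℕ) :
    IsBandedPlanePartition (n + 1) f ↔ ∀ (d : Fin n) (j : ℕ),
      diagonals (n + 1) f d.succ j ≤ diagonals (n + 1) f d.castSucc j ∧
      diagonals (n + 1) f d.castSucc (j + 1) ≤ diagonals (n + 1) f d.succ j := by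
  constructor
  · intro h d j
    simp only [diagonals_apply]
    exact ⟨h.row _ _ (by simp [stairEquiv]; omega) (by simp [stairEquiv]),
      h.col _ _ (by simp [stairEquiv]; omega) (by simp [stairEquiv])⟩
  · intro h
    constructor
    · intro p q h1 h2
      have hp := p.2
      have hq := q.2
      simp only [stairRegion, Set.mem_ofPred_eq] at hp hq
      rw [apply_eq_diagonals _ f p, apply_eq_diagonals _ f q]
      have h3 := (h ⟨p.1.1 - p.1.2 - 1, by omega⟩ p.1.2).2
      have e1 : (stairEquiv (n + 1) q).1 = Fin.castSucc ⟨p.1.1 - p.1.2 - 1, by omega⟩ := by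
        ext
        simp only [stairEquiv, Equiv.coe_fn_mk, Fin.val_castSucc]
        omega
      have e2 : (stairEquiv (n + 1) p).1 = Fin.succ ⟨p.1.1 - p.1.2 - 1, by omega⟩ := by
        ext
        simp only [stairEquiv, Equiv.coe_fn_mk, Fin.val_succ]
        omega
      have e3 : (stairEquiv (n + 1) q).2 = p.1.2 + 1 := h2
      rw [e1, e2, e3]
      exact h3
    · intro p q h1 h2
      have hp := p.2
      have hq := q.2
      simp only [stairRegion, Set.mem_ofPred_eq] at hp hq
      rw [apply_eq_diagonals _ f p, apply_eq_diagonals _ f q]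
      have h3 := (h ⟨p.1.1 - p.1.2, by omega⟩ p.1.2).1
      have e1 : (stairEquiv (n + 1) q).1 = Fin.succ ⟨p.1.1 - p.1.2, by omega⟩ := by
        ext
        simp only [stairEquiv, Equiv.coe_fn_mk, Fin.val_succ]
        omega
      have e2 : (stairEquiv (n + 1) p).1 = Fin.castSucc ⟨p.1.1 - p.1.2, by omega⟩ := by
        ext
        simp only [stairEquiv, Equiv.coe_fn_mk, Fin.val_castSucc]
      have e3 : (stairEquiv (n + 1) q).2 = p.1.2 := h2
      rw [e1, e2, e3]
      exact h3

/-- No condition compares two cells of one diagonal directly; the comparison goes through a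
neighbouring diagonal, which for the last one is its predecessor. A single diagonal (`n = 0`) would
be unconstrained. -/
theorem antitone_diagonals {n : ℕ} (hn : n ≠ 0) {f : stairRegion (n + 1) →₀ ℕ}
    (hf : IsBandedPlanePartition (n + 1) f) (d : Fin (n + 1)) :
    Antitone (diagonals (n + 1) f d) := by
  rw [isBandedPlanePartition_iff] at hf
  refine antitone_nat_of_succ_le fun j => ?_
  induction d using Fin.lastCases with
  | last =>
    obtain ⟨k, rfl⟩ := Nat.exists_eq_succ_of_ne_zero hn
    have h1 := hf (Fin.last k) (j + 1)
    have h2 := hf (Fin.last k) j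
    rw [Fin.succ_last] at h1 h2
    exact h1.1.trans h2.2
  | cast d => exact (hf d j).2.trans (hf d j).1

/-- Banded plane partitions are the chains of their diagonals. -/
def bandedEquivChain {n : ℕ} (hn : n ≠ 0) :
    {f : stairRegion (n + 1) →₀ ℕ // IsBandedPlanePartition (n + 1) f} ≃
      {c : Fin (n + 1) → Ptn // Ptn.IsChain c} where
  toFun f := ⟨fun d => ⟨diagonals (n + 1) f.1 d, antitone_diagonals hn f.2 d⟩,
    fun d j => (isBandedPlanePartition_iff f.1).1 f.2 d j⟩
  invFun c := ⟨(diagonals (n + 1)).symm fun d => (c.1 d).1, by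
    rw [isBandedPlanePartition_iff, Equiv.apply_symm_apply]
    exact fun d j => c.2 d j⟩
  left_inv f := Subtype.ext (by simp)
  right_inv c := Subtype.ext (funext fun d => Subtype.ext (by simp))

theorem tsum_bandedPlanePartition (q : ℝ≥0∞) {n : ℕ} (hn : n ≠ 0) :
    ∑' f : {f : stairRegion (n + 1) →₀ ℕ // IsBandedPlanePartition (n + 1) f},
      q ^ (f.1.sum fun _ a => a) =
      Ptn.freeBoundarySum (q ^ (n + 1)) (Ptn.powList q n) := by
  rw [← Ptn.tsum_chainWeight]
  have h : ∑' c : Fin (n + 1) → Ptn, Ptn.chainWeight q c =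
      ∑' c : {c : Fin (n + 1) → Ptn // Ptn.IsChain c}, q ^ ∑ d, (c.1 d).size := by
    refine Eq.trans ?_ (tsum_subtype {c : Fin (n + 1) → Ptn | Ptn.IsChain c}
      fun c => q ^ ∑ d, (c d).size).symm
    refine tsum_congr fun c => ?_
    simp [Ptn.chainWeight, Set.indicator]
  rw [h, ← (bandedEquivChain hn).tsum_eq]
  refine tsum_congr fun f => ?_
  rw [← sum_diagonals]
  rfl

theorem tsum_bppCount (q : ℝ≥0∞) (hq : q ≠ 0) {n : ℕ} (hn : n ≠ 0)
    (hfin : Ptn.freeBoundarySum (q ^ (n + 1)) (Ptn.powList q n) ≠ ∞) :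
    ∑' k : ℕ, (bppCount (n + 1) k : ℝ≥0∞) * q ^ k =
      Ptn.freeBoundarySum (q ^ (n + 1)) (Ptn.powList q n) := by
  rw [← tsum_bandedPlanePartition q hn] at hfin ⊢
  set size : {f : stairRegion (n + 1) →₀ ℕ // IsBandedPlanePartition (n + 1) f} → ℕ :=
    fun f => f.1.sum fun _ a => a with hsize
  have h0 : ∑' f, q ^ size f = ∑' k : ℕ, (ENat.card {f // size f = k} : ℝ≥0∞) * q ^ k := by
    rw [← (Equiv.sigmaFiberEquiv size).tsum_eq, ENNReal.tsum_sigma']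
    refine tsum_congr fun k => ?_
    rw [← ENNReal.tsum_const]
    refine tsum_congr fun f => ?_
    exact congrArg (q ^ ·) f.2
  -- `Set.ncard` is zero on infinite sets, so the fibres must be shown finite. An infinite fibre
  -- would give an infinite term because `q ≠ 0`.
  have h1 : ∀ k, ENat.card {f // size f = k} ≠ ⊤ := by
    intro k hk
    refine hfin ?_
    rw [h0]
    refine top_unique (le_trans ?_ (ENNReal.le_tsum k))
    rw [hk, ENat.toENNReal_top, ENNReal.top_mul (pow_ne_zero _ hq)]
  rw [h0]
  refine tsum_congr fun k => ?_
  congr 1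
  have e : {f // size f = k} ≃ {f : stairRegion (n + 1) →₀ ℕ |
      IsBandedPlanePartition (n + 1) f ∧ (f.sum fun _ a => a) = k} :=
    Equiv.subtypeSubtypeEquivSubtypeInter _ fun f : stairRegion (n + 1) →₀ ℕ =>
      (f.sum fun _ a => a) = k
  rw [bppCount, ← Nat.card_coe_set_eq, ← Nat.card_congr e]
  have : Finite {f // size f = k} := by
    by_contra hinf
    rw [not_finite_iff_infinite] at hinf
    exact h1 k ENat.card_eq_top_of_infinite
  rw [ENat.card_eq_coe_natCard]
  rfl

end

/-! ### The product formula in terms of `logQGamma` -/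

section

open scoped ENNReal
open Finset

/-- The function `-log (1 - e⁻ᵗ)`. -/
def negLogOneSubExp (t : ℝ) : ℝ := -Real.log (1 - Real.exp (-t))

/-- The logarithm of `∏ₙ (1 - e^{-(n + a) T})⁻¹`. -/
def logQGamma (a T : ℝ) : ℝ := ∑' n : ℕ, negLogOneSubExp ((n + a) * T)

theorem one_sub_exp_neg_pos {t : ℝ} (ht : 0 < t) : 0 < 1 - Real.exp (-t) :=
  sub_pos.2 (Real.exp_lt_one_iff.2 (neg_neg_of_pos ht))

theorem exp_negLogOneSubExp {t : ℝ} (ht : 0 < t) :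
    Real.exp (negLogOneSubExp t) = (1 - Real.exp (-t))⁻¹ := by
  rw [negLogOneSubExp, Real.exp_neg, Real.exp_log (one_sub_exp_neg_pos ht)]

theorem negLogOneSubExp_nonneg {t : ℝ} (ht : 0 < t) : 0 ≤ negLogOneSubExp t := by
  have h := one_sub_exp_neg_pos ht
  have := Real.log_nonpos h.le (by linarith [Real.exp_pos (-t)])
  rw [negLogOneSubExp]
  linarith

theorem negLogOneSubExp_le {t c : ℝ} (hc : 0 < c) (ht : c ≤ t) :
    negLogOneSubExp t ≤ (1 - Real.exp (-c))⁻¹ * Real.exp (-t) := by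
  have h0 := one_sub_exp_neg_pos (hc.trans_le ht)
  have hc' := one_sub_exp_neg_pos hc
  have h1 := Real.one_sub_inv_le_log_of_pos h0
  have h2 : (1 - Real.exp (-t))⁻¹ - 1 = (1 - Real.exp (-t))⁻¹ * Real.exp (-t) := by
    field_simp
    ring
  have h3 : (1 - Real.exp (-t))⁻¹ ≤ (1 - Real.exp (-c))⁻¹ :=
    inv_anti₀ hc' (by linarith [Real.exp_le_exp.2 (neg_le_neg ht)])
  have h4 := mul_le_mul_of_nonneg_right h3 (Real.exp_nonneg (-t))
  rw [negLogOneSubExp]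
  linarith

theorem summable_negLogOneSubExp {a T : ℝ} (ha : 0 < a) (hT : 0 < T) :
    Summable fun n : ℕ => negLogOneSubExp ((n + a) * T) := by
  have hpos : ∀ n : ℕ, a * T ≤ (n + a) * T := fun n => by
    have : (0 : ℝ) ≤ n := n.cast_nonneg
    nlinarith
  refine Summable.of_nonneg_of_le
    (fun n => negLogOneSubExp_nonneg ((mul_pos ha hT).trans_le (hpos n)))
    (fun n => negLogOneSubExp_le (mul_pos ha hT) (hpos n)) (Summable.mul_left _ ?_)
  have h := (Real.summable_exp_nat_mul_iff.2 (neg_neg_of_pos hT)).mul_left (Real.exp (-(a * T)))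
  refine h.congr fun n => ?_
  rw [← Real.exp_add]
  congr 1
  ring

/-- The positive integers are sorted by residue modulo `m`. -/
theorem sum_logQGamma_div {m : ℕ} (hm : m ≠ 0) {T : ℝ} (hT : 0 < T) :
    ∑ r ∈ range m, logQGamma ((r + 1) / m) (m * T) = logQGamma 1 T := by
  have : NeZero m := ⟨hm⟩
  have hm' : (0 : ℝ) < m := by exact_mod_cast Nat.pos_of_ne_zero hm
  have hs := summable_negLogOneSubExp one_pos hT
  have h0 := ((Nat.divModEquiv m).symm.summable_iff.2 hs).tsum_prod
  rw [logQGamma, ← (Nat.divModEquiv m).symm.tsum_eq]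
  refine Eq.trans ?_ h0.symm
  have h1 : ∀ (n : ℕ) (r : Fin m), negLogOneSubExp ((((Nat.divModEquiv m).symm (n, r) : ℕ) + 1) * T)
      = negLogOneSubExp ((n + ((r : ℕ) + 1) / m) * (m * T)) := by
    intro n r
    congr 1
    simp only [Nat.divModEquiv, Equiv.coe_fn_symm_mk]
    push_cast
    field_simp
    ring
  simp only [Function.comp_apply, tsum_fintype, h1]
  rw [Summable.tsum_finsetSum, Fin.sum_univ_eq_sum_range fun r : ℕ =>
    ∑' n : ℕ, negLogOneSubExp ((n + ((r : ℕ) + 1) / m) * (m * T))]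
  · rfl
  · exact fun r _ => summable_negLogOneSubExp (by positivity) (by positivity)

namespace Ptn

theorem reflectFactor_append (L : List ℝ≥0∞) (x : ℝ≥0∞) :
    reflectFactor (L ++ [x]) =
      reflectFactor L * ((1 - x)⁻¹ * (L.map fun y => (1 - y * x)⁻¹).prod) := by
  induction L with
  | nil => simp [reflectFactor]
  | cons y L ih =>
    rw [List.cons_append, reflectFactor, reflectFactor, ih, List.map_append, List.prod_append,
      List.map_cons, List.prod_cons, List.map_cons, List.prod_cons, List.map_nil, List.prod_nil]
    ring

theorem reflectFactor_map_range (f : ℕ → ℝ≥0∞) (n : ℕ) :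
    reflectFactor ((List.range n).map f) =
      ∏ j ∈ range n, ((1 - f j)⁻¹ * ∏ k ∈ range j, (1 - f k * f j)⁻¹) := by
  induction n with
  | zero => rfl
  | succ n ih =>
    rw [List.range_succ, List.map_append, List.map_singleton, reflectFactor_append, ih,
      Finset.prod_range_succ, List.map_map]
    rfl

theorem inv_one_sub_ofReal_exp {t : ℝ} (ht : 0 < t) :
    (1 - ENNReal.ofReal (Real.exp (-t)))⁻¹ = ENNReal.ofReal (Real.exp (negLogOneSubExp t)) := by
  rw [exp_negLogOneSubExp ht, ENNReal.ofReal_inv_of_pos (one_sub_exp_neg_pos ht),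
    ENNReal.ofReal_sub _ (Real.exp_nonneg _), ENNReal.ofReal_one]

theorem ofReal_exp_pow (t : ℝ) (n : ℕ) :
    ENNReal.ofReal (Real.exp (-t)) ^ n = ENNReal.ofReal (Real.exp (-(n * t))) := by
  rw [← ENNReal.ofReal_pow (Real.exp_nonneg _), ← Real.exp_nat_mul, mul_neg]

theorem prod_ofReal_exp {ι : Type*} (s : Finset ι) (f : ι → ℝ) :
    ∏ i ∈ s, ENNReal.ofReal (Real.exp (f i)) = ENNReal.ofReal (Real.exp (∑ i ∈ s, f i)) := by
  rw [Real.exp_sum, ENNReal.ofReal_prod_of_nonneg fun _ _ => Real.exp_nonneg _]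

theorem reflectFactor_exp {t : ℕ → ℝ} (ht : ∀ j, 0 < t j) (n : ℕ) :
    reflectFactor ((List.range n).map fun j => ENNReal.ofReal (Real.exp (-t j))) =
      ENNReal.ofReal (Real.exp (∑ j ∈ range n, (negLogOneSubExp (t j) +
        ∑ k ∈ range j, negLogOneSubExp (t k + t j)))) := by
  rw [reflectFactor_map_range, ← prod_ofReal_exp]
  refine Finset.prod_congr rfl fun j _ => ?_
  rw [Real.exp_add, ENNReal.ofReal_mul (Real.exp_nonneg _), inv_one_sub_ofReal_exp (ht j),
    ← prod_ofReal_exp]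
  congr 1
  refine Finset.prod_congr rfl fun k _ => ?_
  rw [← inv_one_sub_ofReal_exp (add_pos (ht k) (ht j)), neg_add, Real.exp_add,
    ENNReal.ofReal_mul (Real.exp_nonneg _)]

open Filter Topology

theorem tsum_sizePow_exp {T : ℝ} (hT : 0 < T) :
    ∑' mu, sizePow (ENNReal.ofReal (Real.exp (-T))) mu =
      ENNReal.ofReal (Real.exp (logQGamma 1 T)) := by
  have h1 : ∀ n : ℕ, ∏ i ∈ range n, (1 - ENNReal.ofReal (Real.exp (-T)) ^ (i + 1))⁻¹ =
      ENNReal.ofReal (Real.exp (∑ i ∈ range n, negLogOneSubExp ((i + 1) * T))) := by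
    intro n
    rw [← prod_ofReal_exp]
    refine Finset.prod_congr rfl fun i _ => ?_
    rw [ofReal_exp_pow, inv_one_sub_ofReal_exp (by positivity), Nat.cast_succ]
  rw [tsum_sizePow]
  simp only [h1]
  have hmono : Monotone fun n : ℕ =>
      ENNReal.ofReal (Real.exp (∑ i ∈ range n, negLogOneSubExp ((i + 1) * T))) := by
    refine monotone_nat_of_le_succ fun n => ENNReal.ofReal_le_ofReal (Real.exp_le_exp.2 ?_)
    rw [Finset.sum_range_succ]
    exact le_add_of_nonneg_right (negLogOneSubExp_nonneg (by positivity))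
  refine tendsto_nhds_unique (tendsto_atTop_iSup hmono) ?_
  refine ENNReal.tendsto_ofReal ((Real.continuous_exp.tendsto _).comp ?_)
  exact (summable_negLogOneSubExp one_pos hT).hasSum.tendsto_sum_nat

/-- With `u = q ^ (n + 1)`, the factors with one parameter run through the exponents not divisible
by `n + 1`, and the partition sum in `u` supplies the multiples; together they give `logQGamma 1 T`.
A product of two parameters gains `u ^ 2` in each round, hence the modulus `2 * (n + 1)`. -/
theorem freeBoundarySum_powList_exp {n : ℕ} {T : ℝ} (hT : 0 < T) :
    freeBoundarySum (ENNReal.ofReal (Real.exp (-T)) ^ (n + 1))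
      (powList (ENNReal.ofReal (Real.exp (-T))) n) =
      ENNReal.ofReal (Real.exp (logQGamma 1 T + ∑ j ∈ range n, ∑ k ∈ range j,
        logQGamma ((((k : ℝ) + 1) + (j + 1)) / (2 * (n + 1))) (2 * (n + 1) * T))) := by
  set q := ENNReal.ofReal (Real.exp (-T)) with hq
  have hn : (0 : ℝ) < n + 1 := by positivity
  have hq1 : q < 1 := by
    rw [hq, ENNReal.ofReal_lt_one]
    exact Real.exp_lt_one_iff.2 (neg_neg_of_pos hT)
  have hfin : freeBoundarySum (q ^ (n + 1)) (powList q n) ≠ ∞ := by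
    rw [← tsum_chainWeight]
    refine ne_top_of_le_ne_top ?_ (tsum_chainWeight_le q n)
    rw [tsum_sizePow_exp hT]
    exact ENNReal.pow_ne_top ENNReal.ofReal_ne_top
  refine tendsto_nhds_unique
    (tendsto_prod_reflectFactor (pow_lt_one' hq1 (Nat.succ_ne_zero n)) (powList q n) hfin) ?_
  have h1 : ∀ i : ℕ, reflectFactor ((powList q n).map ((q ^ (n + 1)) ^ i * ·)) =
      ENNReal.ofReal (Real.exp (∑ j ∈ range n,
        (negLogOneSubExp ((i + ((j : ℝ) + 1) / ((n + 1 : ℕ) : ℝ)) * ((n + 1 : ℕ) * T)) +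
        ∑ k ∈ range j, negLogOneSubExp
          ((i + (((k : ℝ) + 1) + (j + 1)) / (2 * (n + 1))) * (2 * (n + 1) * T))))) := by
    intro i
    have h2 := reflectFactor_exp (t := fun j : ℕ => (i * (n + 1) + (j + 1)) * T)
      (fun j => by positivity) n
    have h3 : (powList q n).map ((q ^ (n + 1)) ^ i * ·) = (List.range n).map fun j : ℕ =>
        ENNReal.ofReal (Real.exp (-((i * (n + 1) + (j + 1)) * T))) := by
      rw [powList, List.map_map]
      refine List.map_congr_left fun j _ => ?_
      simp only [Function.comp_apply]
      rw [← pow_mul, ← pow_add, hq, ofReal_exp_pow]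
      congr 3
      push_cast
      ring
    rw [h3, h2]
    congr 2
    refine Finset.sum_congr rfl fun j _ => ?_
    congr 1
    · congr 1
      push_cast
      field_simp
    · refine Finset.sum_congr rfl fun k _ => ?_
      congr 1
      field_simp
      ring
  simp only [h1, prod_ofReal_exp]
  rw [hq, ofReal_exp_pow, tsum_sizePow_exp (by positivity)]
  simp only [← ENNReal.ofReal_mul (Real.exp_nonneg _), ← Real.exp_add]
  refine ENNReal.tendsto_ofReal ((Real.continuous_exp.tendsto _).comp ?_)
  rw [← sum_logQGamma_div (Nat.succ_ne_zero n) hT, Finset.sum_range_succ, add_right_comm,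
    ← Finset.sum_add_distrib]
  have hlast : (((n : ℕ) : ℝ) + 1) / ((n + 1 : ℕ) : ℝ) = 1 := by
    push_cast
    field_simp
  rw [hlast]
  refine Tendsto.add_const _ ?_
  refine HasSum.tendsto_sum_nat (hasSum_sum fun j _ => ?_)
  refine HasSum.add (summable_negLogOneSubExp (by positivity) (by positivity)).hasSum
    (hasSum_sum fun k _ => ?_)
  exact (summable_negLogOneSubExp (by positivity) (by positivity)).hasSum

end Ptn

theorem hasSum_bppCount_mul_exp {n : ℕ} (hn : n ≠ 0) {T : ℝ} (hT : 0 < T) :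
    HasSum (fun k => (bppCount (n + 1) k : ℝ) * Real.exp (-T) ^ k)
      (Real.exp (logQGamma 1 T + ∑ j ∈ range n, ∑ k ∈ range j,
        logQGamma ((((k : ℝ) + 1) + (j + 1)) / (2 * (n + 1))) (2 * (n + 1) * T))) := by
  have h0 := Ptn.freeBoundarySum_powList_exp (n := n) hT
  have h := tsum_bppCount (ENNReal.ofReal (Real.exp (-T)))
    (ENNReal.ofReal_pos.2 (Real.exp_pos _)).ne' hn (by rw [h0]; exact ENNReal.ofReal_ne_top)
  rw [h0] at h
  have h2 := ENNReal.hasSum_toReal (h.trans_ne ENNReal.ofReal_ne_top)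
  have h3 := congrArg ENNReal.toReal h
  rw [ENNReal.tsum_toReal_eq (ENNReal.ne_top_of_tsum_ne_top (h.trans_ne ENNReal.ofReal_ne_top)),
    ENNReal.toReal_ofReal (Real.exp_nonneg _)] at h3
  rw [h3] at h2
  refine h2.congr_fun ?_
  intro k
  rw [ENNReal.toReal_mul, ENNReal.toReal_pow, ENNReal.toReal_ofReal (Real.exp_nonneg _),
    ENNReal.toReal_natCast]

end

/-! ### Fourier series of hyperbolic cosines -/

section

open Finset Filter Topology

section CoshFourier

open Complex in
theorem fourierCoeffOn_cosh {c : ℝ} (hc : 0 < c) (n : ℤ) :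
    fourierCoeffOn zero_lt_one (fun x : ℝ => ((Real.cosh (c * (1 / 2 - x)) : ℝ) : ℂ)) n =
      ((Real.sinh (c / 2) * (2 * c / (c ^ 2 + 4 * Real.pi ^ 2 * n ^ 2)) : ℝ) : ℂ) := by
  set w : ℂ := 2 * Real.pi * I * n with hw
  have hne : ∀ s : ℝ, s ≠ 0 → (s : ℂ) - w ≠ 0 := by
    intro s hs h
    have := congrArg re h
    simp [hw] at this
    exact hs this
  have hd1 := hne c hc.ne'
  have hd2 := hne (-c) (neg_ne_zero.2 hc.ne')
  push_cast at hd2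
  have hd3 : -(c : ℂ) - w = -(c + w) := by ring
  have hd4 : (c : ℂ) + w ≠ 0 := fun h => hd2 (by rw [hd3, h, neg_zero])
  have hint : ∀ x : ℝ, fourier (-n) (x : AddCircle ((1 : ℝ) - 0)) •
      ((Real.cosh (c * (1 / 2 - x)) : ℝ) : ℂ) =
      exp (c / 2) / 2 * exp ((-c - w) * x) + exp (-(c / 2)) / 2 * exp ((c - w) * x) := by
    intro x
    rw [fourier_coe_apply, smul_eq_mul, ofReal_cosh, cosh]
    push_cast
    rw [mul_div_assoc', mul_add, ← exp_add, ← exp_add, div_mul_eq_mul_div, div_mul_eq_mul_div,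
      ← exp_add, ← exp_add, ← add_div]
    congr 3 <;> rw [hw] <;> ring
  rw [fourierCoeffOn_eq_integral]
  simp only [hint]
  rw [intervalIntegral.integral_add, intervalIntegral.integral_const_mul,
    intervalIntegral.integral_const_mul, integral_exp_mul_complex hd2, integral_exp_mul_complex hd1]
  · have hw1 : exp w = 1 := by
      rw [hw, mul_comm]
      exact exp_int_mul_two_pi_mul_I n
    have e1 : exp ((-c - w) * (1 : ℝ)) = exp (-c) := by
      rw [ofReal_one, mul_one, exp_sub, hw1, div_one]
    have e2 : exp ((c - w) * (1 : ℝ)) = exp c := by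
      rw [ofReal_one, mul_one, exp_sub, hw1, div_one]
    have e3 : exp (c : ℂ) = exp (c / 2) * exp (c / 2) := by
      rw [← exp_add]
      congr 1
      ring
    have e4 : exp (-(c : ℂ)) = exp (-(c / 2)) * exp (-(c / 2)) := by
      rw [← exp_add]
      congr 1
      ring
    have e5 : exp ((c : ℂ) / 2) * exp (-(c / 2)) = 1 := by
      rw [← exp_add, add_neg_cancel, exp_zero]
    have hden : ((c ^ 2 + 4 * Real.pi ^ 2 * n ^ 2 : ℝ) : ℂ) = (c - w) * (c + w) := by
      push_cast
      rw [hw]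
      linear_combination (4 * (Real.pi : ℂ) ^ 2 * n ^ 2) * I_sq
    rw [e1, e2, e3, e4, ofReal_mul, ofReal_div, hden, ofReal_sinh, sinh, hd3]
    simp only [ofReal_zero, mul_zero, exp_zero]
    push_cast
    simp only [sub_zero, div_one, one_smul]
    field_simp
    linear_combination (((c : ℂ) - w) * (-exp (-(c / 2))) + (c + w) * exp (c / 2)) * e5
  · exact (by fun_prop : Continuous _).intervalIntegrable _ _
  · exact (by fun_prop : Continuous _).intervalIntegrable _ _

/-- The `1`-periodic extension of `cosh (c (1 / 2 - x))` from the unit interval. -/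
def periodicCosh (c : ℝ) : C(UnitAddCircle, ℂ) where
  toFun := AddCircle.liftIco 1 0 fun x : ℝ => ((Real.cosh (c * (1 / 2 - x)) : ℝ) : ℂ)
  continuous_toFun := AddCircle.liftIco_zero_continuous
    (by
      rw [← Real.cosh_neg]
      congr 2
      ring)
    (by fun_prop : Continuous _).continuousOn

theorem periodicCosh_apply (c : ℝ) {x : ℝ} (hx0 : 0 ≤ x) (hx1 : x < 1) :
    periodicCosh c (x : UnitAddCircle) = ((Real.cosh (c * (1 / 2 - x)) : ℝ) : ℂ) :=
  AddCircle.liftIco_coe_apply (p := 1) (a := 0)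
    (f := fun x : ℝ => ((Real.cosh (c * (1 / 2 - x)) : ℝ) : ℂ)) ⟨hx0, by rwa [zero_add]⟩

theorem fourierCoeff_periodicCosh {c : ℝ} (hc : 0 < c) (n : ℤ) :
    fourierCoeff (periodicCosh c) n =
      ((Real.sinh (c / 2) * (2 * c / (c ^ 2 + 4 * Real.pi ^ 2 * n ^ 2)) : ℝ) : ℂ) := by
  rw [← fourierCoeffOn_cosh hc n]
  refine (fourierCoeff_liftIco_eq (T := 1) (a := 0)
    (fun x : ℝ => ((Real.cosh (c * (1 / 2 - x)) : ℝ) : ℂ)) n).trans ?_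
  congr 1
  simp

theorem summable_one_div_sq_add {c : ℝ} (hc : 0 < c) :
    Summable fun n : ℤ => 2 * c / (c ^ 2 + 4 * Real.pi ^ 2 * n ^ 2) := by
  have h0 : Summable fun n : ℤ => 2 * c / (4 * Real.pi ^ 2) * |1 / (n : ℝ) ^ 2| :=
    ((Real.summable_one_div_int_pow.2 one_lt_two).abs).mul_left _
  refine Summable.of_norm_bounded_eventually h0 ?_
  rw [Filter.eventually_cofinite]
  refine (Set.finite_singleton (0 : ℤ)).subset fun n hn => ?_
  by_contra hne
  refine hn ?_
  have hn2 : (0 : ℝ) < (n : ℝ) ^ 2 := by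
    have : (n : ℝ) ≠ 0 := by exact_mod_cast hne
    positivity
  have hpi := Real.pi_pos
  rw [Real.norm_of_nonneg (by positivity), abs_of_nonneg (by positivity), div_mul_div_comm, mul_one]
  refine div_le_div_of_nonneg_left (by positivity) (by positivity) ?_
  linarith [sq_nonneg c]

/-- The coefficients decay like 1/n², so the Fourier series of the continuous function `periodicCosh
c` converges to it at every point. The value `x = 0` is admitted since the transformation below
needs it. -/
theorem hasSum_cosh_div_sinh {c : ℝ} (hc : 0 < c) {x : ℝ} (hx0 : 0 ≤ x) (hx1 : x < 1) :
    HasSum (fun k : ℕ => 4 * c / (c ^ 2 + 4 * Real.pi ^ 2 * (k + 1) ^ 2) *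
      Real.cos (2 * Real.pi * (k + 1) * x))
      (Real.cosh (c * (1 / 2 - x)) / Real.sinh (c / 2) - 2 / c) := by
  have hcoeff := fourierCoeff_periodicCosh hc
  have hsum : Summable (fourierCoeff (periodicCosh c)) := by
    refine Summable.congr ?_ fun n => (hcoeff n).symm
    exact Complex.hasSum_ofReal.2
      ((summable_one_div_sq_add hc).mul_left (Real.sinh (c / 2))).hasSum |>.summable
  -- Pairing `n` with `-n` from `n = 0` on counts the constant coefficient twice; subtracting the
  -- whole term `n = 0` at the end leaves `-2 / c`.
  have h1 := (has_pointwise_sum_fourier_series_of_summable hsum (x : UnitAddCircle)).nat_add_neg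
  have hval := periodicCosh_apply c hx0 hx1
  have hterm : ∀ n : ℕ, fourierCoeff (periodicCosh c) n • fourier n (x : UnitAddCircle) +
      fourierCoeff (periodicCosh c) (-n) • fourier (-n) (x : UnitAddCircle) =
      ((Real.sinh (c / 2) * (4 * c / (c ^ 2 + 4 * Real.pi ^ 2 * n ^ 2) *
        Real.cos (2 * Real.pi * n * x)) : ℝ) : ℂ) := by
    intro n
    rw [hcoeff, hcoeff, fourier_coe_apply, fourier_coe_apply]
    push_cast
    rw [Complex.cos]
    have e1 : 2 * (Real.pi : ℂ) * Complex.I * n * x / 1 = 2 * Real.pi * n * x * Complex.I := by ring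
    have e2 : 2 * (Real.pi : ℂ) * Complex.I * -n * x / 1 = -(2 * Real.pi * n * x) * Complex.I := by
      ring
    rw [e1, e2, neg_sq, smul_eq_mul, smul_eq_mul]
    ring
  have hs : 0 < Real.sinh (c / 2) := Real.sinh_pos_iff.2 (by linarith)
  have h0 : fourierCoeff (periodicCosh c) 0 • fourier 0 (x : UnitAddCircle) =
      ((Real.sinh (c / 2) * (2 / c) : ℝ) : ℂ) := by
    rw [hcoeff, fourier_zero, smul_eq_mul, mul_one]
    congr 2
    simp
    field_simp
  rw [hval, h0, ← Complex.ofReal_add] at h1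
  have h2 := (Complex.hasSum_ofReal.1 (h1.congr_fun fun n => (hterm n).symm)).div_const
    (Real.sinh (c / 2))
  simp only [mul_div_cancel_left₀ _ hs.ne'] at h2
  have h3 := (hasSum_nat_add_iff' 1).2 h2
  rw [Finset.sum_range_one] at h3
  have hval' : (Real.cosh (c * (1 / 2 - x)) + Real.sinh (c / 2) * (2 / c)) / Real.sinh (c / 2) -
      4 * c / (c ^ 2 + 4 * Real.pi ^ 2 * ((0 : ℕ) : ℝ) ^ 2) *
        Real.cos (2 * Real.pi * ((0 : ℕ) : ℝ) * x) =
      Real.cosh (c * (1 / 2 - x)) / Real.sinh (c / 2) - 2 / c := by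
    simp
    field_simp
    ring
  rw [hval'] at h3
  refine h3.congr_fun fun k => ?_
  rw [Nat.cast_add, Nat.cast_one]

end CoshFourier

/-! ### Conditionally convergent cosine series -/

section CosSum

theorem exists_bound_sum_cos {x : ℝ} (hx0 : 0 < x) (hx1 : x < 1) :
    ∃ C, ∀ N : ℕ, ‖∑ k ∈ range N, Real.cos (2 * Real.pi * (k + 1) * x)‖ ≤ C := by
  set z : ℂ := Complex.exp (2 * Real.pi * x * Complex.I) with hz
  have hz1 : ‖z‖ = 1 := by
    rw [hz]
    exact_mod_cast Complex.norm_exp_ofReal_mul_I (2 * Real.pi * x)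
  have hne : z ≠ 1 := by
    intro h
    obtain ⟨n, hn⟩ := Complex.exp_eq_one_iff.1 h
    have : (x : ℂ) = n := by
      have h2 := Complex.two_pi_I_ne_zero
      have h3 : (x : ℂ) * (2 * Real.pi * Complex.I) = n * (2 * Real.pi * Complex.I) := by
        rw [← hn]
        ring
      exact mul_right_cancel₀ h2 h3
    have h3 : x = n := by exact_mod_cast this
    rw [h3] at hx0 hx1
    have h4 : (0 : ℤ) < n := by exact_mod_cast hx0
    have h5 : n < (1 : ℤ) := by exact_mod_cast hx1
    omega
  have hre : ∀ k : ℕ, Real.cos (2 * Real.pi * (k + 1) * x) = (z * z ^ k).re := by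
    intro k
    rw [← pow_succ', hz, ← Complex.exp_nat_mul]
    have : ((k + 1 : ℕ) : ℂ) * (2 * Real.pi * x * Complex.I) =
        ((2 * Real.pi * (k + 1) * x : ℝ) : ℂ) * Complex.I := by
      push_cast
      ring
    rw [this, Complex.exp_ofReal_mul_I_re]
  refine ⟨2 / ‖z - 1‖, fun N => ?_⟩
  simp only [hre, ← Complex.re_sum, ← Finset.mul_sum]
  refine (Complex.abs_re_le_norm _).trans ?_
  rw [norm_mul, hz1, one_mul, geom_sum_eq hne, norm_div]
  gcongr
  refine (norm_sub_le _ _).trans ?_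
  rw [norm_pow, hz1, one_pow, norm_one]
  norm_num

/-- Summation by parts. The bound is independent of `N`, so it can serve as a majorant for partial
sums. -/
theorem norm_sum_mul_le_of_antitone {b z : ℕ → ℝ} {C : ℝ} (hb : Antitone b) (hb0 : ∀ n, 0 ≤ b n)
    (hz : ∀ N, ‖∑ k ∈ range N, z k‖ ≤ C) (N : ℕ) :
    ‖∑ k ∈ range N, b k * z k‖ ≤ C * b 0 := by
  have h := Finset.sum_range_by_parts b z N
  simp only [smul_eq_mul] at h
  rw [h]
  have h1 : ‖∑ i ∈ range (N - 1), (b (i + 1) - b i) * ∑ j ∈ range (i + 1), z j‖ ≤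
      ∑ i ∈ range (N - 1), (b i - b (i + 1)) * C := by
    refine (norm_sum_le _ _).trans (Finset.sum_le_sum fun i _ => ?_)
    have h2 := hb (Nat.le_add_right i 1)
    rw [norm_mul, Real.norm_eq_abs (b (i + 1) - b i), abs_of_nonpos (by linarith), neg_sub]
    exact mul_le_mul_of_nonneg_left (hz _) (by linarith)
  rw [← Finset.sum_mul, Finset.sum_range_sub'] at h1
  refine (norm_sub_le _ _).trans ?_
  have h3 : ‖b (N - 1) * ∑ i ∈ range N, z i‖ ≤ b (N - 1) * C := by
    rw [norm_mul, Real.norm_of_nonneg (hb0 _)]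
    exact mul_le_mul_of_nonneg_left (hz _) (hb0 _)
  linarith

theorem norm_one_sub_exp_two_pi_mul_I {x : ℝ} (hx0 : 0 < x) (hx1 : x < 1) :
    ‖1 - Complex.exp (2 * Real.pi * x * Complex.I)‖ = 2 * Real.sin (Real.pi * x) := by
  have hs : 0 < Real.sin (Real.pi * x) :=
    Real.sin_pos_of_pos_of_lt_pi (by positivity) (by nlinarith [Real.pi_pos])
  have h1 : 1 - Complex.exp (2 * Real.pi * x * Complex.I) =
      -(2 * Complex.I) * ((Real.sin (Real.pi * x) : ℝ) : ℂ) *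
        Complex.exp (((Real.pi * x : ℝ) : ℂ) * Complex.I) := by
    rw [Complex.ofReal_sin, Complex.sin]
    have e1 : Complex.exp (2 * Real.pi * x * Complex.I) =
      Complex.exp (((Real.pi * x : ℝ) : ℂ) * Complex.I) *
        Complex.exp (((Real.pi * x : ℝ) : ℂ) * Complex.I) := by
      rw [← Complex.exp_add]
      congr 1
      push_cast
      ring
    have e2 : Complex.exp (-((Real.pi * x : ℝ) : ℂ) * Complex.I) *
        Complex.exp (((Real.pi * x : ℝ) : ℂ) * Complex.I) = 1 := by
      rw [← Complex.exp_add]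
      simp
    rw [e1]
    linear_combination (Complex.exp (-((Real.pi * x : ℝ) : ℂ) * Complex.I) *
        Complex.exp (((Real.pi * x : ℝ) : ℂ) * Complex.I) -
      Complex.exp (((Real.pi * x : ℝ) : ℂ) * Complex.I) ^ 2) * Complex.I_sq - e2
  rw [h1, norm_mul, norm_mul, Complex.norm_exp_ofReal_mul_I, Complex.norm_real,
    Real.norm_of_nonneg hs.le]
  simp

/-- Dirichlet's test gives convergence, and Abel's limit theorem identifies the value as the
boundary value of the real part of -log(1 - z) at z = e^(2πix). -/
theorem tendsto_sum_cos_div {x : ℝ} (hx0 : 0 < x) (hx1 : x < 1) :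
    Tendsto (fun N => ∑ k ∈ range N, 1 / ((k : ℝ) + 1) * Real.cos (2 * Real.pi * (k + 1) * x))
      atTop (𝓝 (-Real.log (2 * Real.sin (Real.pi * x)))) := by
  obtain ⟨C, hbound⟩ := exists_bound_sum_cos hx0 hx1
  have hcs := Antitone.cauchySeq_series_mul_of_tendsto_zero_of_bounded
    (f := fun k : ℕ => 1 / ((k : ℝ) + 1)) (z := fun k : ℕ => Real.cos (2 * Real.pi * (k + 1) * x))
    (fun a b hab => by
      have : (a : ℝ) ≤ b := by exact_mod_cast hab
      exact one_div_le_one_div_of_le (by positivity) (by linarith))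
    tendsto_one_div_add_atTop_nhds_zero_nat hbound
  obtain ⟨l, hl⟩ := cauchySeq_tendsto_of_complete hcs
  simp only [smul_eq_mul] at hl
  suffices l = -Real.log (2 * Real.sin (Real.pi * x)) by rwa [← this]
  -- The term at `0` vanishes because `1 / 0 = 0`, so the index can be shifted to fit the power
  -- series.
  set f : ℕ → ℝ := fun k => 1 / (k : ℝ) * Real.cos (2 * Real.pi * k * x) with hf
  have hl' : Tendsto (fun N => ∑ k ∈ range N, f k) atTop (𝓝 l) := by
    rw [← tendsto_add_atTop_iff_nat 1]
    refine hl.congr fun N => ?_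
    rw [Finset.sum_range_succ']
    simp [hf]
  have habel := Real.tendsto_tsum_powerSeries_nhdsWithin_lt hl'
  set z : ℂ := Complex.exp (2 * Real.pi * x * Complex.I) with hz
  have hz1 : ‖z‖ = 1 := by
    rw [hz]
    exact_mod_cast Complex.norm_exp_ofReal_mul_I (2 * Real.pi * x)
  have hsum : ∀ r : ℝ, r ∈ Set.Ioo (0 : ℝ) 1 → ∑' n, f n * r ^ n = -Real.log ‖1 - r * z‖ := by
    intro r hr
    have hnorm : ‖(r : ℂ) * z‖ < 1 := by
      rw [norm_mul, hz1, mul_one, Complex.norm_real, Real.norm_of_nonneg hr.1.le]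
      exact hr.2
    have h1 := Complex.hasSum_re (Complex.hasSum_taylorSeries_neg_log hnorm)
    rw [Complex.neg_re, Complex.log_re] at h1
    rw [← h1.tsum_eq]
    refine tsum_congr fun n => ?_
    have e1 : ((r : ℂ) * z) ^ n / n = ((r ^ n / n : ℝ) : ℂ) *
        Complex.exp (((2 * Real.pi * n * x : ℝ) : ℂ) * Complex.I) := by
      rw [mul_pow, hz, ← Complex.exp_nat_mul]
      push_cast
      rw [show (n : ℂ) * (2 * Real.pi * x * Complex.I) = 2 * Real.pi * n * x * Complex.I by ring]
      ring
    rw [e1, Complex.re_ofReal_mul, Complex.exp_ofReal_mul_I_re, hf]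
    simp only
    ring
  have hne : 2 * Real.sin (Real.pi * x) ≠ 0 := by
    have : 0 < Real.sin (Real.pi * x) :=
      Real.sin_pos_of_pos_of_lt_pi (by positivity) (by nlinarith [Real.pi_pos])
    positivity
  have hlim : Tendsto (fun r : ℝ => -Real.log ‖1 - r * z‖) (𝓝[<] 1)
      (𝓝 (-Real.log (2 * Real.sin (Real.pi * x)))) := by
    have h1 : ContinuousAt (fun r : ℝ => -Real.log ‖1 - r * z‖) 1 := by
      refine ContinuousAt.neg (ContinuousAt.log (by fun_prop) ?_)
      rw [Complex.ofReal_one, one_mul, hz, norm_one_sub_exp_two_pi_mul_I hx0 hx1]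
      exact hne
    have h2 := h1.tendsto
    rw [Complex.ofReal_one, one_mul, hz, norm_one_sub_exp_two_pi_mul_I hx0 hx1] at h2
    exact h2.mono_left nhdsWithin_le_nhds
  refine tendsto_nhds_unique habel (hlim.congr' ?_)
  filter_upwards [Ioo_mem_nhdsLT (zero_lt_one' ℝ)] with r hr
  exact (hsum r hr).symm

end CosSum

end

/-! ### The transformation T ↦ 4π²/T -/

section

open Finset Filter Topology

/-- The function `e⁻ᵗ / (1 - e⁻ᵗ)`. -/
def boseFactor (t : ℝ) : ℝ := Real.exp (-t) / (1 - Real.exp (-t))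

theorem boseFactor_nonneg {t : ℝ} (ht : 0 < t) : 0 ≤ boseFactor t :=
  div_nonneg (Real.exp_nonneg _) (one_sub_exp_neg_pos ht).le

theorem cosh_div_sinh_eq {t y : ℝ} (ht : 0 < t) :
    Real.cosh (t * (1 / 2 - y)) / Real.sinh (t / 2) =
      (Real.exp (-(t * y)) + Real.exp (-(t * (1 - y)))) / (1 - Real.exp (-t)) := by
  have h0 := (one_sub_exp_neg_pos ht).ne'
  have hs : Real.sinh (t / 2) ≠ 0 := (Real.sinh_pos_iff.2 (by linarith)).ne'
  rw [div_eq_div_iff hs h0, Real.cosh_eq, Real.sinh_eq]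
  have e1 : Real.exp (t * (1 / 2 - y)) = Real.exp (t / 2) * Real.exp (-(t * y)) := by
    rw [← Real.exp_add]
    ring_nf
  have e2 : Real.exp (-(t * (1 / 2 - y))) = Real.exp (t / 2) * Real.exp (-(t * (1 - y))) := by
    rw [← Real.exp_add]
    ring_nf
  have e3 : Real.exp (-(t / 2)) = Real.exp (t / 2) * Real.exp (-t) := by
    rw [← Real.exp_add]
    ring_nf
  rw [e1, e2, e3]
  ring

theorem cosh_div_sinh_half {t : ℝ} (ht : 0 < t) :
    Real.cosh (t * (1 / 2 - 0)) / Real.sinh (t / 2) = 1 + 2 * boseFactor t := by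
  rw [cosh_div_sinh_eq ht, boseFactor]
  have h0 := (one_sub_exp_neg_pos ht).ne'
  field_simp
  simp
  ring

/-- The Lambert series of `logQGamma`. -/
theorem hasSum_logQGamma {a T : ℝ} (ha : 0 < a) (hT : 0 < T) :
    HasSum (fun j : ℕ => 1 / ((j : ℝ) + 1) *
      (Real.exp (-((j + 1) * T * a)) / (1 - Real.exp (-((j + 1) * T))))) (logQGamma a T) := by
  set F : ℕ × ℕ → ℝ := fun p => Real.exp (-((p.1 + a) * T)) ^ (p.2 + 1) / ((p.2 : ℝ) + 1) with hF
  have hpos : ∀ n : ℕ, 0 < (n + a) * T := fun n => by positivity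
  have hrow : ∀ n : ℕ, HasSum (fun j => F (n, j)) (negLogOneSubExp ((n + a) * T)) := fun n => by
    have hlt : |Real.exp (-((n + a) * T))| < 1 := by
      rw [abs_of_nonneg (Real.exp_nonneg _), Real.exp_lt_one_iff]
      linarith [hpos n]
    have h := Real.hasSum_pow_div_log_of_abs_lt_one hlt
    rw [negLogOneSubExp]
    exact h.congr_fun fun j => rfl
  have hcol : ∀ j : ℕ, HasSum (fun n => F (n, j)) (1 / ((j : ℝ) + 1) *
      (Real.exp (-((j + 1) * T * a)) / (1 - Real.exp (-((j + 1) * T))))) := fun j => by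
    have hj : 0 < ((j : ℝ) + 1) * T := by positivity
    have h := (hasSum_geometric_of_lt_one (Real.exp_nonneg (-((j + 1) * T)))
      (Real.exp_lt_one_iff.2 (neg_neg_of_pos hj))).mul_left
        (1 / ((j : ℝ) + 1) * Real.exp (-((j + 1) * T * a)))
    rw [← div_eq_mul_inv, mul_div_assoc] at h
    refine h.congr_fun fun n => ?_
    simp only [hF]
    rw [← Real.exp_nat_mul, ← Real.exp_nat_mul, mul_assoc, ← Real.exp_add, one_div_mul_eq_div]
    congr 2
    push_cast
    ring
  -- All terms are nonnegative, so summability of the row sums permits summing by columns.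
  have hsum : Summable F := by
    refine (summable_prod_of_nonneg fun p => ?_).2
      ⟨fun n => (hrow n).summable, ?_⟩
    · simp only [hF, Pi.zero_apply]
      positivity
    · simp only [(hrow _).tsum_eq]
      exact summable_negLogOneSubExp ha hT
  have h1 : HasSum F (logQGamma a T) := by
    have h := hsum.hasSum.prod_fiberwise hrow
    rw [logQGamma, h.tsum_eq]
    exact hsum.hasSum
  exact ((Equiv.prodComm ℕ ℕ).hasSum_iff.2 h1).prod_fiberwise hcol

/-- The Lambert series of the transformed side. -/
theorem summable_boseFactor {t : ℝ} (ht : 0 < t) :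
    Summable fun k : ℕ => 1 / ((k : ℝ) + 1) * boseFactor ((k + 1) * t) := by
  have h := (hasSum_logQGamma one_pos ht).summable
  refine h.congr fun k => ?_
  rw [boseFactor, mul_one]

theorem logQGamma_one_eq_tsum {t : ℝ} (ht : 0 < t) :
    logQGamma 1 t = ∑' k : ℕ, 1 / ((k : ℝ) + 1) * boseFactor ((k + 1) * t) := by
  rw [← (hasSum_logQGamma one_pos ht).tsum_eq]
  refine tsum_congr fun k => ?_
  rw [boseFactor, mul_one]

theorem hasSum_one_div_succ_sq : HasSum (fun k : ℕ => 1 / ((k : ℝ) + 1) ^ 2) (Real.pi ^ 2 / 6) := by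
  have h := (hasSum_nat_add_iff' 1).2 hasSum_zeta_two
  simpa using h

theorem hasSum_cos_div_succ_sq {x : ℝ} (hx0 : 0 ≤ x) (hx1 : x ≤ 1) :
    HasSum (fun k : ℕ => 1 / ((k : ℝ) + 1) ^ 2 * Real.cos (2 * Real.pi * (k + 1) * x))
      (Real.pi ^ 2 * (x ^ 2 - x + 1 / 6)) := by
  have h := (hasSum_nat_add_iff' 1).2
    (hasSum_one_div_nat_pow_mul_cos one_ne_zero (x := x) ⟨hx0, hx1⟩)
  have h2 := bernoulliFun_two x
  rw [bernoulliFun] at h2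
  rw [mul_one, h2, Finset.sum_range_one] at h
  have e : (-1 : ℝ) ^ (1 + 1) * (2 * Real.pi) ^ 2 / 2 / (Nat.factorial 2 : ℕ) *
      (x ^ 2 - x + 6⁻¹) - 1 / ((0 : ℕ) : ℝ) ^ 2 * Real.cos (2 * Real.pi * ((0 : ℕ) : ℝ) * x) =
      Real.pi ^ 2 * (x ^ 2 - x + 1 / 6) := by
    rw [Nat.cast_zero, zero_pow two_ne_zero, div_zero, zero_mul, Nat.factorial_two]
    push_cast
    ring
  rw [e] at h
  refine h.congr_fun fun k => ?_
  rw [Nat.cast_add, Nat.cast_one]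

/-- The two Lambert series combine to hyperbolic quotients in `j`, each a cosine series in `k` with
coefficients `b j k`. For fixed `k` the same kernel, now read as a series in `j`, is the expansion
at `x = 0` with parameter 4π²(k + 1)/T. Its parts 1/(k + 1) and 1/(k + 1)² give the sine logarithm
and the Bernoulli polynomial, and the rest is the inverted Lambert series. -/
theorem logQGamma_add_logQGamma_one_sub {a T : ℝ} (ha0 : 0 < a) (ha1 : a < 1) (hT : 0 < T) :
    logQGamma a T + logQGamma (1 - a) T =
      Real.pi ^ 2 / (3 * T) - T / 2 * (a ^ 2 - a + 1 / 6) - Real.log (2 * Real.sin (Real.pi * a)) +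
      ∑' k : ℕ, 2 * (1 / ((k : ℝ) + 1) * boseFactor ((k + 1) * (4 * Real.pi ^ 2 / T))) *
        Real.cos (2 * Real.pi * (k + 1) * a) := by
  have hpi := Real.pi_pos
  obtain ⟨C, hC⟩ := exists_bound_sum_cos ha0 ha1
  set b : ℕ → ℕ → ℝ := fun j k =>
    4 * T / (((j + 1) * T) ^ 2 + 4 * Real.pi ^ 2 * (k + 1) ^ 2) with hb
  set z : ℕ → ℝ := fun k => Real.cos (2 * Real.pi * (k + 1) * a) with hz
  -- the sums over `k`
  have hk : ∀ j : ℕ, HasSum (fun k => b j k * z k) (1 / ((j : ℝ) + 1) *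
      (Real.cosh ((j + 1) * T * (1 / 2 - a)) / Real.sinh ((j + 1) * T / 2) -
        2 / ((j + 1) * T))) := fun j => by
    have h := (hasSum_cosh_div_sinh (c := (j + 1) * T) (by positivity) ha0.le ha1).mul_left
      (1 / ((j : ℝ) + 1))
    refine h.congr_fun fun k => ?_
    simp only [hb, hz]
    field_simp
  -- the sum over `j` of the sums over `k`
  have hpair : HasSum (fun j : ℕ => 1 / ((j : ℝ) + 1) *
      (Real.cosh ((j + 1) * T * (1 / 2 - a)) / Real.sinh ((j + 1) * T / 2) -
        2 / ((j + 1) * T))) (logQGamma a T + logQGamma (1 - a) T - Real.pi ^ 2 / (3 * T)) := by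
    have h1 := (hasSum_logQGamma ha0 hT).add (hasSum_logQGamma (sub_pos.2 ha1) hT)
    have h2 := h1.sub (hasSum_one_div_succ_sq.mul_left (2 / T))
    have e : 2 / T * (Real.pi ^ 2 / 6) = Real.pi ^ 2 / (3 * T) := by
      field_simp
      ring
    rw [e] at h2
    refine h2.congr_fun fun j => ?_
    rw [cosh_div_sinh_eq (by positivity), add_div]
    field_simp
  -- the sums over `j`
  have hj : ∀ k : ℕ, HasSum (fun j => b j k) (1 / ((k : ℝ) + 1) +
      2 * (1 / ((k : ℝ) + 1) * boseFactor ((k + 1) * (4 * Real.pi ^ 2 / T))) -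
      T / (2 * Real.pi ^ 2) * (1 / ((k : ℝ) + 1) ^ 2)) := fun k => by
    have hc : 0 < ((k : ℝ) + 1) * (4 * Real.pi ^ 2 / T) := by positivity
    have h := (hasSum_cosh_div_sinh hc le_rfl one_pos).mul_left (1 / ((k : ℝ) + 1))
    rw [cosh_div_sinh_half hc] at h
    have e : 1 / ((k : ℝ) + 1) * (1 + 2 * boseFactor ((k + 1) * (4 * Real.pi ^ 2 / T)) -
        2 / ((k + 1) * (4 * Real.pi ^ 2 / T))) = 1 / ((k : ℝ) + 1) +
        2 * (1 / ((k : ℝ) + 1) * boseFactor ((k + 1) * (4 * Real.pi ^ 2 / T))) -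
        T / (2 * Real.pi ^ 2) * (1 / ((k : ℝ) + 1) ^ 2) := by
      have e' : 2 / ((k + 1) * (4 * Real.pi ^ 2 / T)) = T / (2 * Real.pi ^ 2) * (1 / (k + 1)) := by
        field_simp
        norm_num
      rw [e', ← one_div_pow]
      ring
    rw [e] at h
    refine h.congr_fun fun j => ?_
    simp only [hb, mul_zero, Real.cos_zero, mul_one]
    field_simp
    ring
  have hb0 : ∀ j k, 0 ≤ b j k := fun j k => by
    simp only [hb]
    positivity
  have hanti : ∀ j, Antitone (b j) := fun j => by
    refine antitone_nat_of_succ_le fun k => ?_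
    simp only [hb]
    refine div_le_div_of_nonneg_left (by positivity) (by positivity) ?_
    push_cast
    gcongr
    linarith
  -- The double series is not absolutely convergent: summed over `j`, the coefficients decay only
  -- like 1/k. The interchange is by dominated convergence for partial sums in `k`, with the
  -- majorant obtained by summation by parts.
  have hdom : Tendsto (fun N => ∑' j, ∑ k ∈ range N, b j k * z k) atTop
      (𝓝 (logQGamma a T + logQGamma (1 - a) T - Real.pi ^ 2 / (3 * T))) := by
    rw [← hpair.tsum_eq]
    refine tendsto_tsum_of_dominated_convergence (bound := fun j => C * b j 0)
      ((hj 0).summable.mul_left C) (fun j => (hk j).tendsto_sum_nat)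
      (Eventually.of_forall fun N j => norm_sum_mul_le_of_antitone (hanti j) (hb0 j) hC N)
  have hswap : ∀ N, ∑' j, ∑ k ∈ range N, b j k * z k =
      ∑ k ∈ range N, 1 / ((k : ℝ) + 1) * z k +
      ∑ k ∈ range N, 2 * (1 / ((k : ℝ) + 1) * boseFactor ((k + 1) * (4 * Real.pi ^ 2 / T))) * z k -
      T / (2 * Real.pi ^ 2) * ∑ k ∈ range N, 1 / ((k : ℝ) + 1) ^ 2 * z k := by
    intro N
    rw [Summable.tsum_finsetSum fun k _ => (hj k).summable.mul_right (z k), Finset.mul_sum,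
      ← Finset.sum_add_distrib, ← Finset.sum_sub_distrib]
    refine Finset.sum_congr rfl fun k _ => ?_
    rw [tsum_mul_right, (hj k).tsum_eq]
    ring
  have hsum : Summable fun k : ℕ =>
      2 * (1 / ((k : ℝ) + 1) * boseFactor ((k + 1) * (4 * Real.pi ^ 2 / T))) * z k := by
    refine Summable.of_norm_bounded ((summable_boseFactor
      (by positivity : 0 < 4 * Real.pi ^ 2 / T)).mul_left 2) fun k => ?_
    have h0 := boseFactor_nonneg (by positivity : 0 < ((k : ℝ) + 1) * (4 * Real.pi ^ 2 / T))
    rw [norm_mul, Real.norm_of_nonneg (by positivity)]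
    exact mul_le_of_le_one_right (by positivity) (Real.abs_cos_le_one _)
  have hlim := ((tendsto_sum_cos_div ha0 ha1).add hsum.hasSum.tendsto_sum_nat).sub
    ((hasSum_cos_div_succ_sq ha0.le ha1.le).tendsto_sum_nat.const_mul (T / (2 * Real.pi ^ 2)))
  have h := tendsto_nhds_unique (hdom.congr hswap) hlim
  have e : T / (2 * Real.pi ^ 2) * (Real.pi ^ 2 * (a ^ 2 - a + 1 / 6)) =
      T / 2 * (a ^ 2 - a + 1 / 6) := by
    field_simp
  rw [e] at h
  linarith

/-- Isolates the only term that is singular as `a` tends to 0. -/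
theorem logQGamma_eq_add {a T : ℝ} (ha : 0 < a) (hT : 0 < T) :
    logQGamma a T = negLogOneSubExp (a * T) + logQGamma (1 + a) T := by
  rw [logQGamma, (summable_negLogOneSubExp ha hT).tsum_eq_zero_add, logQGamma]
  congr 1
  · simp
  · refine tsum_congr fun n => ?_
    push_cast
    ring_nf

theorem continuousAt_logQGamma {a T : ℝ} (ha : 0 < a) (hT : 0 < T) :
    ContinuousAt (fun x => logQGamma x T) a := by
  have hpos : ∀ (n : ℕ), ∀ x ∈ Set.Ioi (a / 2), 0 < (n + x) * T := fun n x hx => by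
    have : 0 < x := (half_pos ha).trans hx
    positivity
  have h : ContinuousOn (fun x => logQGamma x T) (Set.Ioi (a / 2)) := by
    refine continuousOn_tsum (fun n => ?_) (summable_negLogOneSubExp (half_pos ha) hT) ?_
    · refine ContinuousOn.neg (ContinuousOn.log (by fun_prop) fun x hx => ?_)
      exact (one_sub_exp_neg_pos (hpos n x hx)).ne'
    · intro n x hx
      have h0 : 0 < (n + a / 2) * T := by positivity
      rw [Real.norm_of_nonneg (negLogOneSubExp_nonneg (hpos n x hx)), negLogOneSubExp,
        negLogOneSubExp]
      refine neg_le_neg (Real.log_le_log (one_sub_exp_neg_pos h0) ?_)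
      have hx' : (n + a / 2) * T ≤ (n + x) * T :=
        mul_le_mul_of_nonneg_right (by linarith [Set.mem_Ioi.1 hx]) hT.le
      linarith [Real.exp_le_exp.2 (neg_le_neg hx')]
  exact h.continuousAt (Ioi_mem_nhds (by linarith))

theorem tendsto_one_sub_exp_div {T : ℝ} :
    Tendsto (fun a => (1 - Real.exp (-(a * T))) / a) (𝓝[>] 0) (𝓝 T) := by
  have h : HasDerivAt (fun a : ℝ => 1 - Real.exp (-(a * T))) T 0 := by
    have h1 := (((hasDerivAt_id (0 : ℝ)).mul_const T).neg.exp).const_sub 1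
    simpa using h1
  have h2 := h.tendsto_slope_zero_right
  refine h2.congr fun a => ?_
  simp [div_eq_inv_mul]

theorem tendsto_two_sin_div : Tendsto (fun a => 2 * Real.sin (Real.pi * a) / a) (𝓝[>] 0)
    (𝓝 (2 * Real.pi)) := by
  have h : HasDerivAt (fun a : ℝ => 2 * Real.sin (Real.pi * a)) (2 * Real.pi) 0 := by
    have h1 := (((hasDerivAt_id (0 : ℝ)).const_mul Real.pi).sin).const_mul 2
    simpa using h1
  refine h.tendsto_slope_zero_right.congr fun a => ?_
  simp [div_eq_inv_mul]

/-- The modular transformation of the logarithm of the partition generating function. -/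
theorem logQGamma_one_eq {T : ℝ} (hT : 0 < T) :
    logQGamma 1 T = Real.pi ^ 2 / (6 * T) - T / 24 + Real.log (T / (2 * Real.pi)) / 2 +
      logQGamma 1 (4 * Real.pi ^ 2 / T) := by
  have hpi := Real.pi_pos
  have hT' : 0 < 4 * Real.pi ^ 2 / T := by positivity
  have hev : ∀ᶠ a : ℝ in 𝓝[>] 0, 0 < a ∧ a < 1 := by
    filter_upwards [Ioo_mem_nhdsGT (zero_lt_one' ℝ)] with a ha using ha
  have h1 : Tendsto (fun a => logQGamma (1 + a) T + logQGamma (1 - a) T) (𝓝[>] 0)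
      (𝓝 (logQGamma 1 T + logQGamma 1 T)) := by
    refine Tendsto.mono_left ?_ nhdsWithin_le_nhds
    have e1 : Tendsto (fun a : ℝ => 1 + a) (𝓝 0) (𝓝 1) := by
      have : ContinuousAt (fun a : ℝ => 1 + a) 0 := by fun_prop
      simpa using this.tendsto
    have e2 : Tendsto (fun a : ℝ => 1 - a) (𝓝 0) (𝓝 1) := by
      have : ContinuousAt (fun a : ℝ => 1 - a) 0 := by fun_prop
      simpa using this.tendsto
    exact ((continuousAt_logQGamma one_pos hT).tendsto.comp e1).add
      ((continuousAt_logQGamma one_pos hT).tendsto.comp e2)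
  have h2 : Tendsto (fun a => ∑' k : ℕ,
      2 * (1 / ((k : ℝ) + 1) * boseFactor ((k + 1) * (4 * Real.pi ^ 2 / T))) *
        Real.cos (2 * Real.pi * (k + 1) * a)) (𝓝[>] 0) (𝓝 (2 * logQGamma 1 (4 * Real.pi ^ 2 / T))) := by
    have hc : Continuous fun a => ∑' k : ℕ,
        2 * (1 / ((k : ℝ) + 1) * boseFactor ((k + 1) * (4 * Real.pi ^ 2 / T))) *
          Real.cos (2 * Real.pi * (k + 1) * a) := by
      refine continuous_tsum (fun k => by fun_prop) ((summable_boseFactor hT').mul_left 2) ?_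
      intro k a
      have h0 := boseFactor_nonneg (by positivity : 0 < ((k : ℝ) + 1) * (4 * Real.pi ^ 2 / T))
      rw [norm_mul, Real.norm_of_nonneg (by positivity)]
      exact mul_le_of_le_one_right (by positivity) (Real.abs_cos_le_one _)
    have h := (hc.tendsto 0).mono_left (nhdsWithin_le_nhds (s := Set.Ioi 0))
    simp only [mul_zero, Real.cos_zero, mul_one] at h
    rwa [tsum_mul_left, ← logQGamma_one_eq_tsum hT'] at h
  -- The term split off from `logQGamma a T` and the sine term are both logarithmically singular at
  -- 0; their difference has a finite limit once both are divided by `a`.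
  have h3 : Tendsto (fun a => Real.log ((1 - Real.exp (-(a * T))) / a) -
      Real.log (2 * Real.sin (Real.pi * a) / a)) (𝓝[>] 0)
      (𝓝 (Real.log T - Real.log (2 * Real.pi))) :=
    (tendsto_one_sub_exp_div.log hT.ne').sub (tendsto_two_sin_div.log (by positivity))
  have h4 : Tendsto (fun a : ℝ => Real.pi ^ 2 / (3 * T) - T / 2 * (a ^ 2 - a + 1 / 6)) (𝓝[>] 0)
      (𝓝 (Real.pi ^ 2 / (3 * T) - T / 2 * (1 / 6))) := by
    have : ContinuousAt (fun a : ℝ => Real.pi ^ 2 / (3 * T) - T / 2 * (a ^ 2 - a + 1 / 6)) 0 := by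
      fun_prop
    have h := this.tendsto
    norm_num at h
    norm_num
    exact h.mono_left nhdsWithin_le_nhds
  have h5 := tendsto_nhds_unique (h1.congr' ?_) ((h4.add h3).add h2)
  · rw [Real.log_div hT.ne' (by positivity)]
    have e : Real.pi ^ 2 / (6 * T) = Real.pi ^ 2 / (3 * T) / 2 := by
      field_simp
      ring
    rw [e]
    linarith
  · filter_upwards [hev] with a ha
    have hs : 0 < Real.sin (Real.pi * a) :=
      Real.sin_pos_of_pos_of_lt_pi (mul_pos hpi ha.1) (by nlinarith [ha.2])
    have h6 := logQGamma_add_logQGamma_one_sub ha.1 ha.2 hT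
    rw [logQGamma_eq_add ha.1 hT, negLogOneSubExp] at h6
    rw [Real.log_div (one_sub_exp_neg_pos (mul_pos ha.1 hT)).ne' ha.1.ne',
      Real.log_div (by positivity) ha.1.ne']
    linarith

end

/-! ### Sums over pairs -/

section

open Finset Filter Topology

section PairSum

/-- The sum of `f (h + j)` over `1 ≤ h < j ≤ n`. -/
def pairSum (n : ℕ) (f : ℝ → ℝ) : ℝ :=
  ∑ j ∈ range n, ∑ k ∈ range j, f (((k : ℝ) + 1) + (j + 1))

theorem pairSum_succ (n : ℕ) (f : ℝ → ℝ) :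
    pairSum (n + 1) f = pairSum n f + ∑ k ∈ range n, f (((k : ℝ) + 1) + (n + 1)) :=
  Finset.sum_range_succ _ n

theorem two_mul_pairSum (n : ℕ) (f : ℝ → ℝ) :
    2 * pairSum n f = ∑ j ∈ range n, ∑ k ∈ range n, f (((k : ℝ) + 1) + (j + 1)) -
      ∑ j ∈ range n, f (((j : ℝ) + 1) + (j + 1)) := by
  induction n with
  | zero => simp [pairSum]
  | succ n ih =>
    have h : ∑ x ∈ range n, f ((n : ℝ) + 1 + (x + 1)) = ∑ x ∈ range n, f ((x : ℝ) + 1 + (n + 1)) :=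
      Finset.sum_congr rfl fun x _ => by rw [add_comm]
    rw [pairSum_succ, mul_add, ih]
    simp only [Finset.sum_range_succ, Finset.sum_add_distrib]
    rw [h]
    ring

/-- The substitution `h ↦ n + 1 - h` in both members permutes the pairs. It makes a reflection
formula in `a ↦ 1 - a` usable inside a pair sum. -/
theorem pairSum_reflect (n : ℕ) (f : ℝ → ℝ) :
    pairSum n (fun r => f (2 * (n + 1) - r)) = pairSum n f := by
  have key : ∀ j ∈ range n, (((n - 1 - j : ℕ) : ℝ)) = n - 1 - j := fun j hj => by
    have := Finset.mem_range.1 hj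
    rw [Nat.cast_sub (by omega), Nat.cast_sub (by omega), Nat.cast_one]
  have h1 : ∑ j ∈ range n, ∑ k ∈ range n, f (2 * (n + 1) - (((k : ℝ) + 1) + (j + 1))) =
      ∑ j ∈ range n, ∑ k ∈ range n, f (((k : ℝ) + 1) + (j + 1)) := by
    rw [← Finset.sum_range_reflect (fun j : ℕ => ∑ k ∈ range n, f (((k : ℝ) + 1) + (j + 1)))]
    refine Finset.sum_congr rfl fun j hj => ?_
    rw [← Finset.sum_range_reflect (fun k : ℕ => f (((k : ℝ) + 1) + (((n - 1 - j : ℕ) : ℝ) + 1)))]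
    refine Finset.sum_congr rfl fun k hk => ?_
    rw [key j hj, key k hk]
    ring_nf
  have h2 : ∑ j ∈ range n, f (2 * (n + 1) - (((j : ℝ) + 1) + (j + 1))) =
      ∑ j ∈ range n, f (((j : ℝ) + 1) + (j + 1)) := by
    rw [← Finset.sum_range_reflect (fun j : ℕ => f (((j : ℝ) + 1) + (j + 1)))]
    refine Finset.sum_congr rfl fun j hj => ?_
    rw [key j hj]
    ring_nf
  have h3 := two_mul_pairSum n fun r => f (2 * (n + 1) - r)
  rw [h1, h2, ← two_mul_pairSum] at h3
  linarith

theorem pairSum_congr {n : ℕ} {f g : ℝ → ℝ} (h : ∀ r : ℝ, 0 < r → r < 2 * (n + 1) → f r = g r) :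
    pairSum n f = pairSum n g := by
  refine Finset.sum_congr rfl fun j hj => Finset.sum_congr rfl fun k hk => ?_
  have hj' : (j : ℝ) + 1 ≤ n := by exact_mod_cast Finset.mem_range.1 hj
  have hk' : (k : ℝ) + 1 ≤ j := by exact_mod_cast Finset.mem_range.1 hk
  exact h _ (by positivity) (by linarith)

theorem pairSum_add (n : ℕ) (f g : ℝ → ℝ) :
    pairSum n (fun r => f r + g r) = pairSum n f + pairSum n g := by
  simp only [pairSum, Finset.sum_add_distrib]

theorem pairSum_sub (n : ℕ) (f g : ℝ → ℝ) :
    pairSum n (fun r => f r - g r) = pairSum n f - pairSum n g := by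
  simp only [pairSum, Finset.sum_sub_distrib]

theorem pairSum_const_mul (n : ℕ) (c : ℝ) (f : ℝ → ℝ) :
    pairSum n (fun r => c * f r) = c * pairSum n f := by
  simp only [pairSum, Finset.mul_sum]

theorem hasSum_pairSum (n : ℕ) {f : ℕ → ℝ → ℝ} (hf : ∀ r, Summable fun k => f k r) :
    HasSum (fun k => pairSum n (f k)) (pairSum n fun r => ∑' k, f k r) :=
  hasSum_sum fun _ _ => hasSum_sum fun _ _ => (hf _).hasSum

theorem pairSum_const (n : ℕ) (c : ℝ) : pairSum n (fun _ => c) = c * ((n : ℝ) * (n - 1) / 2) := by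
  induction n with
  | zero => simp [pairSum]
  | succ n ih =>
    rw [pairSum_succ, ih]
    simp
    ring

theorem pairSum_id (n : ℕ) : pairSum n (fun r => r) = ((n : ℝ) - 1) * (n * (n + 1) / 2) := by
  have h : ∀ j : ℕ, ∀ c : ℝ, ∑ k ∈ range j, ((k : ℝ) + 1 + c) = j * (j + 1) / 2 + j * c := by
    intro j c
    induction j with
    | zero => simp
    | succ j ih =>
      rw [Finset.sum_range_succ, ih]
      push_cast
      ring
  induction n with
  | zero => simp [pairSum]
  | succ n ih =>
    rw [pairSum_succ, ih, h]
    push_cast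
    ring

theorem pairSum_sq (n : ℕ) : pairSum n (fun r => r ^ 2) =
    ((n : ℝ) - 2) * (n * (n + 1) * (2 * n + 1) / 6) + (n * (n + 1) / 2) ^ 2 := by
  have h : ∀ j : ℕ, ∀ c : ℝ, ∑ k ∈ range j, ((k : ℝ) + 1 + c) ^ 2 =
      j * (j + 1) * (2 * j + 1) / 6 + j * (j + 1) * c + j * c ^ 2 := by
    intro j c
    induction j with
    | zero => simp
    | succ j ih =>
      rw [Finset.sum_range_succ, ih]
      push_cast
      ring
  induction n with
  | zero => simp [pairSum]
  | succ n ih =>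
    rw [pairSum_succ, ih, h]
    push_cast
    ring

/-- The contribution of the pairs to φ_m. -/
theorem pairSum_bernoulli (n : ℕ) :
    pairSum n (fun r => (r / (2 * (n + 1))) ^ 2 - r / (2 * (n + 1)) + 1 / 6) =
      -(((n : ℝ) + 1) ^ 3 - 7 * (n + 1) + 6) / (48 * (n + 1)) := by
  have e : (fun r : ℝ => (r / (2 * ((n : ℝ) + 1))) ^ 2 - r / (2 * (n + 1)) + 1 / 6) =
      fun r => ((1 / (2 * ((n : ℝ) + 1))) ^ 2 * r ^ 2 - (1 / (2 * (n + 1))) * r) + 1 / 6 := by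
    funext r
    ring
  rw [e, pairSum_add, pairSum_sub, pairSum_const_mul, pairSum_const_mul n _ fun r => r,
    pairSum_const, pairSum_id, pairSum_sq]
  have : (n : ℝ) + 1 ≠ 0 := by positivity
  field_simp
  ring

/-- Euler's reflection formula Γ(a)Γ(1 - a) = 2π / (2 sin πa), applied to a pair sum and its
reflection. -/
theorem pairSum_log_Gamma (n : ℕ) :
    2 * pairSum n (fun r => Real.log (Real.Gamma (r / (2 * (n + 1))))) =
      Real.log (2 * Real.pi) * ((n : ℝ) * (n - 1) / 2) -
        pairSum n (fun r => Real.log (2 * Real.sin (Real.pi * (r / (2 * (n + 1)))))) := by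
  have hn : (0 : ℝ) < 2 * (n + 1) := by positivity
  rw [two_mul]
  nth_rewrite 2 [← pairSum_reflect]
  rw [← pairSum_add, ← pairSum_const, ← pairSum_sub]
  refine pairSum_congr fun r hr0 hr1 => ?_
  set a := r / (2 * ((n : ℝ) + 1)) with ha
  have ha0 : 0 < a := div_pos hr0 hn
  have ha1 : a < 1 := (div_lt_one hn).2 hr1
  have h1 : (2 * ((n : ℝ) + 1) - r) / (2 * (n + 1)) = 1 - a := by
    rw [sub_div, div_self hn.ne']
  have hs : 0 < Real.sin (Real.pi * a) :=
    Real.sin_pos_of_pos_of_lt_pi (by positivity) (by nlinarith [Real.pi_pos])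
  rw [h1, ← Real.log_mul (Real.Gamma_pos_of_pos ha0).ne' (Real.Gamma_pos_of_pos (by linarith)).ne',
    Real.Gamma_mul_Gamma_one_sub, ← Real.log_div (by positivity) (by positivity),
    mul_div_mul_left _ _ two_ne_zero]

theorem pairSum_logQGamma (n : ℕ) {T : ℝ} (hT : 0 < T) :
    2 * pairSum n (fun r => logQGamma (r / (2 * (n + 1))) T) =
      pairSum n fun r => Real.pi ^ 2 / (3 * T) -
        T / 2 * ((r / (2 * (n + 1))) ^ 2 - r / (2 * (n + 1)) + 1 / 6) -
        Real.log (2 * Real.sin (Real.pi * (r / (2 * (n + 1))))) +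
        ∑' k : ℕ, 2 * (1 / ((k : ℝ) + 1) * boseFactor ((k + 1) * (4 * Real.pi ^ 2 / T))) *
          Real.cos (2 * Real.pi * (k + 1) * (r / (2 * (n + 1)))) := by
  have hn : (0 : ℝ) < 2 * (n + 1) := by positivity
  rw [two_mul]
  nth_rewrite 2 [← pairSum_reflect]
  rw [← pairSum_add]
  refine pairSum_congr fun r hr0 hr1 => ?_
  have h1 : (2 * ((n : ℝ) + 1) - r) / (2 * (n + 1)) = 1 - r / (2 * (n + 1)) := by
    rw [sub_div, div_self hn.ne']
  rw [h1]
  exact logQGamma_add_logQGamma_one_sub (div_pos hr0 hn) ((div_lt_one hn).2 hr1) hT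

end PairSum

/-! ### Trigonometric sums over pairs -/

section Trig

open Complex in
theorem exp_pi_mul_div_eq_one_iff {m : ℕ} (hm : m ≠ 0) (p : ℕ) :
    exp ((Real.pi * p / m : ℝ) * I) = 1 ↔ 2 * m ∣ p := by
  have hm' : (m : ℂ) ≠ 0 := Nat.cast_ne_zero.2 hm
  have hpi : (Real.pi : ℂ) ≠ 0 := by exact_mod_cast Real.pi_ne_zero
  rw [exp_eq_one_iff]
  constructor
  · rintro ⟨k, hk⟩
    have h1 : (p : ℂ) = 2 * m * k := by
      push_cast at hk
      field_simp at hk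
      linear_combination hk
    have h2 : (p : ℤ) = 2 * m * k := by exact_mod_cast h1
    exact Int.natCast_dvd_natCast.1 ⟨k, by push_cast; exact h2⟩
  · rintro ⟨k, rfl⟩
    refine ⟨k, ?_⟩
    push_cast
    field_simp

open Complex in
theorem exp_pi_mul_div_sq_eq_one_iff {m : ℕ} (hm : m ≠ 0) (p : ℕ) :
    exp ((Real.pi * p / m : ℝ) * I) ^ 2 = 1 ↔ m ∣ p := by
  rw [← exp_nat_mul, ← Nat.mul_dvd_mul_iff_left two_pos, ← exp_pi_mul_div_eq_one_iff hm]
  refine Eq.congr_left (congrArg exp ?_)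
  push_cast
  ring

theorem sum_range_pow_succ {z : ℂ} (hz : z ≠ 1) (n : ℕ) :
    ∑ k ∈ range n, z ^ (k + 1) = (z ^ (n + 1) - 1) / (z - 1) - 1 := by
  have h := geom_sum_eq hz (n + 1)
  rw [Finset.sum_range_succ', pow_zero] at h
  rw [← h]
  ring

open Complex in
-- Over the full square the exponentials factor into the square of a geometric sum; the diagonal is
-- subtracted.
theorem two_mul_pairSum_cos (n : ℕ) (t : ℝ) :
    2 * pairSum n (fun r => Real.cos (t * r)) =
      ((∑ k ∈ range n, exp (t * I) ^ (k + 1)) ^ 2 -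
        ∑ k ∈ range n, (exp (t * I) ^ 2) ^ (k + 1)).re := by
  rw [two_mul_pairSum, sub_re, sq, Finset.sum_mul_sum, re_sum, re_sum]
  have h : ∀ c : ℝ, ∀ N : ℕ, c = N → Real.cos (t * c) = (exp (t * I) ^ N).re := by
    intro c N hc
    rw [← exp_nat_mul, hc, ← exp_ofReal_mul_I_re]
    congr 2
    push_cast
    ring
  congr 1
  · refine Finset.sum_congr rfl fun j _ => ?_
    rw [re_sum]
    refine Finset.sum_congr rfl fun k _ => ?_
    rw [← pow_add]
    refine h _ _ ?_
    push_cast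
    ring
  · refine Finset.sum_congr rfl fun j _ => ?_
    rw [← pow_mul]
    refine h _ _ ?_
    push_cast
    ring

/-- The coefficient of the term with index `p` in the Lambert series. -/
def lambertCoeff (m p : ℕ) : ℝ :=
  if Even p then 1 else -(Real.cos (p * Real.pi / m) / (1 - Real.cos (p * Real.pi / m)))

open Complex in
-- With E = e^(πip/m) one has E^m = (-1)^p. Hence the geometric sum over `1, …, n` is -1 for even p,
-- unless E = 1, and a value depending on E for odd p. The diagonal sum is -1 unless E² = 1. The
-- exceptional cases are the corrections at multiples of m and 2m.
theorem pairSum_cos (n p : ℕ) :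
    pairSum n (fun r => Real.cos (Real.pi * p / (n + 1 : ℕ) * r)) =
      lambertCoeff (n + 1) p - (if (n + 1) ∣ p then ((n : ℝ) + 1) / 2 else 0) +
        (if 2 * (n + 1) ∣ p then ((n : ℝ) + 1) * (n - 1) / 2 else 0) := by
  set t : ℝ := Real.pi * p / (n + 1 : ℕ) with ht
  set E := exp (t * I) with hE
  have hm : n + 1 ≠ 0 := Nat.succ_ne_zero n
  have hm' : ((n : ℝ) + 1) ≠ 0 := by positivity
  have h := two_mul_pairSum_cos n t
  rw [← hE] at h
  have hE1 : E = 1 ↔ 2 * (n + 1) ∣ p := exp_pi_mul_div_eq_one_iff hm p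
  have hE2 : E ^ 2 = 1 ↔ (n + 1) ∣ p := exp_pi_mul_div_sq_eq_one_iff hm p
  have hEm : E ^ (n + 1) = (-1) ^ p := by
    rw [hE, ← exp_nat_mul, ← exp_pi_mul_I, ← exp_nat_mul]
    congr 1
    rw [ht]
    have : ((n : ℂ) + 1) ≠ 0 := by exact_mod_cast hm
    push_cast
    field_simp
  -- the diagonal sum
  have hD : (∑ k ∈ range n, (E ^ 2) ^ (k + 1)) = if (n + 1) ∣ p then (n : ℂ) else -1 := by
    split_ifs with hd
    · rw [hE2.2 hd]
      simp
    · rw [sum_range_pow_succ (fun h => hd (hE2.1 h)), ← pow_mul, mul_comm, pow_mul, hEm, ← pow_mul,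
        mul_comm, pow_mul]
      simp
  rw [hD] at h
  rcases Nat.even_or_odd p with hp | hp
  · rw [lambertCoeff, if_pos hp]
    by_cases h2 : 2 * (n + 1) ∣ p
    · have h1 : (n + 1) ∣ p := (Dvd.intro_left 2 rfl).trans h2
      rw [hE1.2 h2, if_pos h1] at h
      rw [if_pos h1, if_pos h2]
      simp only [one_pow, Finset.sum_const, Finset.card_range, nsmul_eq_mul, mul_one] at h
      have e : ((n : ℂ) ^ 2 - n).re = (n : ℝ) ^ 2 - n := by
        rw [← ofReal_natCast, ← ofReal_pow, ← ofReal_sub, ofReal_re]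
      rw [e] at h
      linarith
    · rw [sum_range_pow_succ (fun h => h2 (hE1.1 h)), hEm, hp.neg_one_pow] at h
      rw [if_neg h2]
      split_ifs at h ⊢ with h1
      · simp at h
        linarith
      · norm_num at h
        linarith
  · have h2 : ¬ 2 * (n + 1) ∣ p := fun h2 =>
      (Nat.not_even_iff_odd.2 hp) (even_iff_two_dvd.2 ((Dvd.intro _ rfl).trans h2))
    have hne : E ≠ 1 := fun h => h2 (hE1.1 h)
    have hEI : E = (Real.cos t : ℂ) + Real.sin t * I := by
      rw [hE, exp_mul_I, ofReal_cos, ofReal_sin]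
    have hc : 1 - Real.cos t ≠ 0 := by
      intro hc
      have hc1 : Real.cos t = 1 := by linarith
      have hs : Real.sin t = 0 := by
        have := Real.sin_sq_add_cos_sq t
        rw [hc1] at this
        nlinarith
      exact hne (by rw [hEI, hc1, hs]; simp)
    -- For odd `p` the sum is -(E + 1)/(E - 1) = i cot(t/2), whose square is real; the relation E² =
    -- 2 cos(t) E - 1 suffices to verify it.
    have hS : (∑ k ∈ range n, E ^ (k + 1)) ^ 2 =
        ((-((1 + Real.cos t) / (1 - Real.cos t)) : ℝ) : ℂ) := by
      rw [sum_range_pow_succ hne, hEm, hp.neg_one_pow]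
      have hsc : (Real.sin t : ℂ) ^ 2 + (Real.cos t : ℂ) ^ 2 = 1 := by
        exact_mod_cast Real.sin_sq_add_cos_sq t
      have hE3 : E ^ 2 = 2 * (Real.cos t : ℂ) * E - 1 := by
        rw [hEI]
        linear_combination (Real.sin t : ℂ) ^ 2 * I_sq - hsc
      have hne' : E - 1 ≠ 0 := sub_ne_zero.2 hne
      have hc' : (1 : ℂ) - Real.cos t ≠ 0 := by exact_mod_cast hc
      rw [ofReal_neg, ofReal_div, ofReal_add, ofReal_sub, ofReal_one]
      field_simp
      linear_combination 2 * hE3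
    have hl : lambertCoeff (n + 1) p = -(Real.cos t / (1 - Real.cos t)) := by
      rw [lambertCoeff, if_neg (Nat.not_even_iff_odd.2 hp), ht, mul_comm (p : ℝ)]
    rw [hS] at h
    rw [hl, if_neg h2]
    have hdiv : (1 + Real.cos t) / (1 - Real.cos t) = 1 + 2 * (Real.cos t / (1 - Real.cos t)) := by
      field_simp
      ring
    rw [hdiv] at h
    split_ifs at h ⊢ with h1
    · rw [← ofReal_natCast, ← ofReal_sub, ofReal_re] at h
      linarith
    · rw [sub_neg_eq_add, ← ofReal_one, ← ofReal_add, ofReal_re] at h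
      linarith

end Trig

/-! ### Lambert series along multiples and odd indices -/

section Multiples

theorem hasSum_ite_dvd {d : ℕ} (hd : d ≠ 0) {g : ℕ → ℝ} {a : ℝ}
    (h : HasSum (fun j => g (d * (j + 1))) a) :
    HasSum (fun k => if d ∣ k + 1 then g (k + 1) else 0) a := by
  have hpos : ∀ j, 0 < d * (j + 1) := fun j => Nat.mul_pos (Nat.pos_of_ne_zero hd) j.succ_pos
  have hinj : Function.Injective fun j => d * (j + 1) - 1 := by
    intro i j hij
    have h1 := hpos i
    have h2 := hpos j
    have h3 : d * (i + 1) = d * (j + 1) := by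
      simp only at hij
      omega
    simpa using Nat.eq_of_mul_eq_mul_left (Nat.pos_of_ne_zero hd) h3
  refine (hinj.hasSum_iff ?_).1 (h.congr_fun fun j => ?_)
  · intro k hk
    rw [if_neg]
    rintro ⟨c, hc⟩
    refine hk ⟨c - 1, ?_⟩
    have : c ≠ 0 := by
      rintro rfl
      simp at hc
    have h4 : c - 1 + 1 = c := by omega
    simp only [h4, ← hc]
    omega
  · have h4 : d * (j + 1) - 1 + 1 = d * (j + 1) := Nat.sub_add_cancel (hpos j)
    simp only [Function.comp_apply, h4]
    rw [if_pos (Dvd.intro _ rfl)]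

theorem hasSum_odd {g : ℕ → ℝ} {a : ℝ} (h : HasSum (fun i => g (2 * i + 1)) a) :
    HasSum (fun k => if Even (k + 1) then 0 else g (k + 1)) a := by
  have hinj : Function.Injective fun i => 2 * i := fun i j hij => by
    simp only at hij
    omega
  refine (hinj.hasSum_iff ?_).1 (h.congr_fun fun j => ?_)
  · intro k hk
    rw [if_pos]
    by_contra hodd
    refine hk ⟨k / 2, ?_⟩
    simp only [Nat.even_iff] at hodd
    simp only
    omega
  · simp [Nat.even_add_one]

theorem hasSum_boseFactor_multiples {d : ℕ} (hd : d ≠ 0) {t : ℝ} (ht : 0 < t) :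
    HasSum (fun k : ℕ => if d ∣ k + 1 then 1 / ((k : ℝ) + 1) * boseFactor ((k + 1) * t) else 0)
      (1 / d * logQGamma 1 (d * t)) := by
  have hd' : (0 : ℝ) < d := by exact_mod_cast Nat.pos_of_ne_zero hd
  have h := (summable_boseFactor (mul_pos hd' ht)).hasSum.mul_left (1 / (d : ℝ))
  rw [← logQGamma_one_eq_tsum (mul_pos hd' ht)] at h
  have h2 := hasSum_ite_dvd hd (g := fun k => 1 / (k : ℝ) * boseFactor (k * t))
    (h.congr_fun fun j => by
      push_cast
      rw [← mul_assoc, one_div_mul_one_div]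
      ring_nf)
  refine h2.congr_fun fun k => ?_
  simp only [Nat.cast_add, Nat.cast_one]

end Multiples

end

/-! ### The identity on the positive real axis -/

section

open Finset Filter Topology

/-- The real Lambert series in the exponent of `L_m`, at `e⁻ʷ`. -/
def lambertSum (m : ℕ) (w : ℝ) : ℝ :=
  ∑ l ∈ Icc 1 m, Real.cos ((2 * l - 1) * Real.pi / m) / (1 - Real.cos ((2 * l - 1) * Real.pi / m)) *
    ∑' j : ℕ, boseFactor (lambertExponent m l j * w) / lambertExponent m l j

theorem lambertCoeff_odd {m : ℕ} (hm : m ≠ 0) (j r : ℕ) :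
    lambertCoeff m (2 * (r + m * j) + 1) =
      -(Real.cos ((2 * ((r + 1 : ℕ) : ℝ) - 1) * Real.pi / m) /
        (1 - Real.cos ((2 * ((r + 1 : ℕ) : ℝ) - 1) * Real.pi / m))) := by
  have hm' : (m : ℝ) ≠ 0 := Nat.cast_ne_zero.2 hm
  have h : ((2 * (r + m * j) + 1 : ℕ) : ℝ) * Real.pi / m =
      (2 * ((r + 1 : ℕ) : ℝ) - 1) * Real.pi / m + j * (2 * Real.pi) := by
    push_cast
    field_simp
    ring
  rw [lambertCoeff, if_neg (by simp), h, Real.cos_add_nat_mul_two_pi]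

/-- The coefficient depends on the odd index only modulo `2 * m`. Writing the index as `2 * (r + m *
j) + 1`, which is `2 * m` times the exponent for `ℓ = r + 1`, turns the sum into the series in L_m.
-/
theorem tsum_lambertCoeff_odd {m : ℕ} (hm : m ≠ 0) (t : ℝ)
    (hs : Summable fun i : ℕ => lambertCoeff m (2 * i + 1) *
      (1 / ((2 * i + 1 : ℕ) : ℝ) * boseFactor (((2 * i + 1 : ℕ) : ℝ) * t))) :
    ∑' i : ℕ, lambertCoeff m (2 * i + 1) *
      (1 / ((2 * i + 1 : ℕ) : ℝ) * boseFactor (((2 * i + 1 : ℕ) : ℝ) * t)) =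
      -(1 / (2 * m)) * lambertSum m (2 * m * t) := by
  have : NeZero m := ⟨hm⟩
  have hm' : (m : ℝ) ≠ 0 := Nat.cast_ne_zero.2 hm
  set g : ℕ → ℝ := fun i => lambertCoeff m (2 * i + 1) *
      (1 / ((2 * i + 1 : ℕ) : ℝ) * boseFactor (((2 * i + 1 : ℕ) : ℝ) * t)) with hg
  have hs' : Summable fun p : ℕ × Fin m => g ((Nat.divModEquiv m).symm p) :=
    (Nat.divModEquiv m).symm.summable_iff.2 hs
  have h1 : ∀ (j : ℕ) (r : Fin m), g ((Nat.divModEquiv m).symm (j, r)) =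
      -(1 / (2 * m)) * (Real.cos ((2 * (((r : ℕ) + 1 : ℕ) : ℝ) - 1) * Real.pi / m) /
        (1 - Real.cos ((2 * (((r : ℕ) + 1 : ℕ) : ℝ) - 1) * Real.pi / m)) *
        (boseFactor (lambertExponent m ((r : ℕ) + 1) j * (2 * m * t)) /
          lambertExponent m ((r : ℕ) + 1) j)) := by
    intro j r
    have e : (Nat.divModEquiv m).symm (j, r) = (r : ℕ) + m * j := by
      simp only [Nat.divModEquiv, Equiv.coe_fn_symm_mk]
      ring
    have hb : ((2 * ((r : ℕ) + m * j) + 1 : ℕ) : ℝ) =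
        2 * m * lambertExponent m ((r : ℕ) + 1) j := by
      rw [lambertExponent]
      push_cast
      field_simp
      ring
    simp only [hg, e, lambertCoeff_odd hm, hb]
    have e2 : 2 * (m : ℝ) * lambertExponent m ((r : ℕ) + 1) j * t =
        lambertExponent m ((r : ℕ) + 1) j * (2 * m * t) := by ring
    rw [e2, one_div, mul_inv]
    ring
  rw [← (Nat.divModEquiv m).symm.tsum_eq, hs'.tsum_prod]
  simp only [tsum_fintype]
  have hr : ∀ r : Fin m, Summable fun j => g ((Nat.divModEquiv m).symm (j, r)) := fun r =>
    hs'.comp_injective (Prod.mk_left_injective r)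
  rw [Summable.tsum_finsetSum fun r _ => hr r]
  simp only [h1, tsum_mul_left]
  rw [← Finset.mul_sum, lambertSum, ← Finset.Ico_succ_right_eq_Icc, Finset.sum_Ico_eq_sum_range]
  congr 1
  rw [Nat.succ_eq_succ, Nat.succ_eq_add_one, Nat.add_sub_cancel]
  rw [Fin.sum_univ_eq_sum_range fun r : ℕ =>
    Real.cos ((2 * ((r + 1 : ℕ) : ℝ) - 1) * Real.pi / m) /
        (1 - Real.cos ((2 * ((r + 1 : ℕ) : ℝ) - 1) * Real.pi / m)) *
        ∑' j : ℕ, (boseFactor (lambertExponent m (r + 1) j * (2 * m * t)) /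
          lambertExponent m (r + 1) j)]
  simp only [add_comm 1]

/-- In `pairSum_cos`, even indices and multiples of `n + 1` and of `2 * (n + 1)` each give a
`logQGamma 1`, while the odd indices give `lambertSum`. For `t = w / (2 * (n + 1))` the three
arguments are `w / (n + 1)`, `w / 2` and `w`, as in K_m. -/
theorem pairSum_tsum_cos (n : ℕ) {t : ℝ} (ht : 0 < t) :
    pairSum n (fun r => ∑' k : ℕ, 2 * (1 / ((k : ℝ) + 1) * boseFactor ((k + 1) * t)) *
      Real.cos (2 * Real.pi * (k + 1) * (r / (2 * (n + 1))))) =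
    logQGamma 1 (2 * t) - logQGamma 1 ((n + 1) * t) +
      ((n : ℝ) - 1) / 2 * logQGamma 1 (2 * (n + 1) * t) -
      1 / (n + 1) * lambertSum (n + 1) (2 * (n + 1) * t) := by
  have hn : ((n : ℝ) + 1) ≠ 0 := by positivity
  set G : ℕ → ℝ := fun k => 1 / ((k : ℝ) + 1) * boseFactor ((k + 1) * t) with hG
  set X := pairSum n (fun r => ∑' k : ℕ, 2 * G k *
      Real.cos (2 * Real.pi * (k + 1) * (r / (2 * (n + 1))))) with hX
  have hG0 : ∀ k, 0 ≤ G k := fun k => by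
    have := boseFactor_nonneg (by positivity : 0 < ((k : ℝ) + 1) * t)
    positivity
  have hsG : Summable G := summable_boseFactor ht
  have hXsum : HasSum (fun k : ℕ => 2 * (G k *
      pairSum n (fun r => Real.cos (Real.pi * (k + 1 : ℕ) / (n + 1 : ℕ) * r)))) X := by
    have h := hasSum_pairSum n (f := fun k r => 2 * G k *
      Real.cos (2 * Real.pi * (k + 1) * (r / (2 * (n + 1))))) fun r => by
        refine Summable.of_norm_bounded (hsG.mul_left 2) fun k => ?_
        have := hG0 k
        rw [norm_mul, Real.norm_of_nonneg (by positivity)]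
        exact mul_le_of_le_one_right (by positivity) (Real.abs_cos_le_one _)
    refine h.congr_fun fun k => ?_
    rw [pairSum_const_mul, ← mul_assoc 2]
    have e : (fun r : ℝ => Real.cos (Real.pi * (k + 1 : ℕ) / (n + 1 : ℕ) * r)) =
        fun r => Real.cos (2 * Real.pi * (k + 1) * (r / (2 * (n + 1)))) := by
      funext r
      congr 1
      push_cast
      field_simp
    rw [e]
  have h1 := hasSum_boseFactor_multiples (Nat.succ_ne_zero n) ht
  have h2 := hasSum_boseFactor_multiples (d := 2 * (n + 1)) (by omega) ht
  have h3 := hasSum_boseFactor_multiples two_ne_zero ht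
  have hall : HasSum (fun k : ℕ => lambertCoeff (n + 1) (k + 1) * G k)
      (X / 2 + ((n : ℝ) + 1) / 2 * (1 / (n + 1 : ℕ) * logQGamma 1 ((n + 1 : ℕ) * t)) -
        ((n : ℝ) + 1) * (n - 1) / 2 *
          (1 / (2 * (n + 1) : ℕ) * logQGamma 1 ((2 * (n + 1) : ℕ) * t))) := by
    refine (((hXsum.div_const 2).add (h1.mul_left _)).sub (h2.mul_left _)).congr_fun fun k => ?_
    rw [pairSum_cos]
    simp only [hG, Nat.succ_eq_add_one]
    split_ifs <;> ring
  have hodd : HasSum (fun k : ℕ => if Even (k + 1) then 0 else lambertCoeff (n + 1) (k + 1) * G k)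
      (X / 2 + ((n : ℝ) + 1) / 2 * (1 / (n + 1 : ℕ) * logQGamma 1 ((n + 1 : ℕ) * t)) -
        ((n : ℝ) + 1) * (n - 1) / 2 *
          (1 / (2 * (n + 1) : ℕ) * logQGamma 1 ((2 * (n + 1) : ℕ) * t)) -
        1 / (2 : ℕ) * logQGamma 1 ((2 : ℕ) * t)) := by
    refine (hall.sub h3).congr_fun fun k => ?_
    simp only [← even_iff_two_dvd]
    split_ifs with h
    · rw [lambertCoeff, if_pos h, hG]
      ring
    · ring
  have hs : Summable fun i : ℕ => lambertCoeff (n + 1) (2 * i + 1) *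
      (1 / ((2 * i + 1 : ℕ) : ℝ) * boseFactor (((2 * i + 1 : ℕ) : ℝ) * t)) := by
    have hinj : Function.Injective fun i => 2 * i := fun i j hij => by
      simp only at hij
      omega
    refine (hodd.summable.comp_injective hinj).congr fun i => ?_
    simp only [Function.comp_apply]
    rw [if_neg (by simp), hG]
    push_cast
    rfl
  have hodd2 := hasSum_odd (g := fun k => lambertCoeff (n + 1) k *
    (1 / (k : ℝ) * boseFactor (k * t))) hs.hasSum
  rw [tsum_lambertCoeff_odd (Nat.succ_ne_zero n) t hs] at hodd2
  have h := hodd.unique (hodd2.congr_fun fun k => by rw [hG]; push_cast; rfl)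
  push_cast at h
  have e1 : ((n : ℝ) + 1) / 2 * (1 / (n + 1) * logQGamma 1 ((n + 1) * t)) =
      logQGamma 1 ((n + 1) * t) / 2 := by
    field_simp
  have e2 : ((n : ℝ) + 1) * (n - 1) / 2 * (1 / (2 * (n + 1)) * logQGamma 1 (2 * (n + 1) * t)) =
      ((n : ℝ) - 1) / 4 * logQGamma 1 (2 * (n + 1) * t) := by
    field_simp
    ring
  have e3 : -(1 / (2 * ((n : ℝ) + 1))) * lambertSum (n + 1) (2 * (n + 1) * t) =
      -(1 / (n + 1) * lambertSum (n + 1) (2 * (n + 1) * t)) / 2 := by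
    field_simp
  rw [e1, e2, e3] at h
  linarith

theorem gConst_pos (n : ℕ) : 0 < gConst (n + 1) := by
  refine mul_pos (Real.rpow_pos_of_pos (by positivity) _) ?_
  refine Finset.prod_pos fun j hj => Finset.prod_pos fun k hk => Real.Gamma_pos_of_pos ?_
  have h1 := (Finset.mem_Ico.1 hj).1
  have h2 : (1 : ℝ) ≤ j := by exact_mod_cast h1
  positivity

theorem log_gConst (n : ℕ) : Real.log (gConst (n + 1)) =
    -((((n : ℝ) + 1) ^ 2 - 3 * (n + 1) + 4) / 4) * Real.log (2 * Real.pi) +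
      pairSum n (fun r => Real.log (Real.Gamma (r / (2 * (n + 1))))) := by
  have h1 : ∏ j ∈ Ico 1 (n + 1), ∏ k ∈ Ico 1 j, Real.Gamma (((k : ℝ) + j) / (2 * (n + 1 : ℕ))) =
      ∏ j ∈ range n, ∏ k ∈ range j, Real.Gamma ((((k : ℝ) + 1) + (j + 1)) / (2 * (n + 1))) := by
    rw [Finset.prod_Ico_eq_prod_range, Nat.add_sub_cancel]
    refine Finset.prod_congr rfl fun j _ => ?_
    rw [Finset.prod_Ico_eq_prod_range, Nat.add_sub_cancel_left]
    refine Finset.prod_congr rfl fun k _ => ?_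
    push_cast
    ring_nf
  have hG : ∀ j k : ℕ, 0 < Real.Gamma ((((k : ℝ) + 1) + (j + 1)) / (2 * (n + 1))) := fun j k =>
    Real.Gamma_pos_of_pos (by positivity)
  rw [gConst, h1, Real.log_mul (Real.rpow_pos_of_pos (by positivity) _).ne'
    (Finset.prod_pos fun j _ => Finset.prod_pos fun k _ => hG j k).ne',
    Real.log_rpow (by positivity), Real.log_prod fun j _ =>
      (Finset.prod_pos fun k _ => hG j k).ne']
  congr 1
  · push_cast
    rfl
  · exact Finset.sum_congr rfl fun j _ => Real.log_prod fun k _ => (hG j k).ne'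

/-- Half of the doubled pair sum at `2 * (n + 1) * T` is added to the transformation of P. The
latter contributes √T, completes the power of 2π in g_m, and raises the exponent of P(z) from (m -
2)/4 to (m + 2)/4. -/
theorem logQGamma_add_pairSum (n : ℕ) {T : ℝ} (hT : 0 < T) :
    logQGamma 1 T + pairSum n (fun r => logQGamma (r / (2 * (n + 1))) (2 * (n + 1) * T)) =
      Real.log (gConst (n + 1)) + Real.log T / 2 + (varpiConst (n + 1) / T + phiConst (n + 1) * T) +
      ((logQGamma 1 (4 * Real.pi ^ 2 / T / (n + 1 : ℕ)) -
        logQGamma 1 (4 * Real.pi ^ 2 / T / 2)) / 2 +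
        ((n + 1 : ℕ) + 2) / 4 * logQGamma 1 (4 * Real.pi ^ 2 / T)) +
      -(1 / (2 * (n + 1 : ℕ))) * lambertSum (n + 1) (4 * Real.pi ^ 2 / T) := by
  have hpi := Real.pi_pos
  have hn : (0 : ℝ) < n + 1 := by positivity
  have hT' : 0 < 2 * ((n : ℝ) + 1) * T := by positivity
  have h := pairSum_logQGamma n hT'
  have e0 : (fun r : ℝ => Real.pi ^ 2 / (3 * (2 * ((n : ℝ) + 1) * T)) -
        2 * ((n : ℝ) + 1) * T / 2 * ((r / (2 * (n + 1))) ^ 2 - r / (2 * (n + 1)) + 1 / 6) -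
        Real.log (2 * Real.sin (Real.pi * (r / (2 * (n + 1))))) +
        ∑' k : ℕ, 2 * (1 / ((k : ℝ) + 1) *
          boseFactor ((k + 1) * (4 * Real.pi ^ 2 / (2 * (n + 1) * T)))) *
          Real.cos (2 * Real.pi * (k + 1) * (r / (2 * (n + 1))))) =
      fun r : ℝ => (((fun _ => Real.pi ^ 2 / (3 * (2 * ((n : ℝ) + 1) * T))) r -
        2 * ((n : ℝ) + 1) * T / 2 * (fun r : ℝ => (r / (2 * ((n : ℝ) + 1))) ^ 2 - r / (2 * (n + 1)) + 1 / 6) r) -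
        (fun r : ℝ => Real.log (2 * Real.sin (Real.pi * (r / (2 * ((n : ℝ) + 1)))))) r) +
        (fun r : ℝ => ∑' k : ℕ, 2 * (1 / ((k : ℝ) + 1) *
          boseFactor ((k + 1) * (4 * Real.pi ^ 2 / (2 * (n + 1) * T)))) *
          Real.cos (2 * Real.pi * (k + 1) * (r / (2 * ((n : ℝ) + 1))))) r := rfl
  rw [e0, pairSum_add, pairSum_sub, pairSum_sub, pairSum_const_mul, pairSum_bernoulli,
    pairSum_const, pairSum_tsum_cos n (by positivity)] at h
  have h2 := pairSum_log_Gamma n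
  have h3 := log_gConst n
  have h4 := logQGamma_one_eq hT
  have e1 : 2 * (4 * Real.pi ^ 2 / (2 * ((n : ℝ) + 1) * T)) = 4 * Real.pi ^ 2 / T / (n + 1) := by
    field_simp
  have e2 : ((n : ℝ) + 1) * (4 * Real.pi ^ 2 / (2 * ((n : ℝ) + 1) * T)) =
      4 * Real.pi ^ 2 / T / 2 := by
    field_simp
  have e3 : 2 * ((n : ℝ) + 1) * (4 * Real.pi ^ 2 / (2 * ((n : ℝ) + 1) * T)) =
      4 * Real.pi ^ 2 / T := by
    field_simp
  rw [e1, e2, e3] at h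
  rw [Real.log_div hT.ne' (by positivity)] at h4
  have e4 : varpiConst (n + 1) / T = Real.pi ^ 2 / (6 * T) +
      Real.pi ^ 2 / (3 * (2 * ((n : ℝ) + 1) * T)) * ((n : ℝ) * (n - 1) / 2) / 2 := by
    rw [varpiConst]
    push_cast
    field_simp
    ring
  have e5 : phiConst (n + 1) * T = - T / 24 - (2 * ((n : ℝ) + 1) * T / 2 *
      (-(((n : ℝ) + 1) ^ 3 - 7 * (n + 1) + 6) / (48 * (n + 1)))) / 2 := by
    rw [phiConst]
    push_cast
    field_simp
    ring
  have e6 : -(1 / (2 * ((n + 1 : ℕ) : ℝ))) * lambertSum (n + 1) (4 * Real.pi ^ 2 / T) =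
      -(1 / ((n : ℝ) + 1) * lambertSum (n + 1) (4 * Real.pi ^ 2 / T)) / 2 := by
    push_cast
    field_simp
  rw [e4, e5, e6, h3]
  push_cast
  linear_combination h4 + h / 2 - h2 / 2

end

/-! ### Complex arguments: holomorphy and continuation -/

section

open Finset Filter Topology

section RealValues

theorem logPartGF_exp_neg {t : ℝ} (ht : 0 < t) :
    logPartGF (Complex.exp (-(t : ℂ))) = (logQGamma 1 t : ℂ) := by
  rw [logPartGF, logQGamma, Complex.ofReal_tsum]
  refine tsum_congr fun k => ?_
  have hk : 0 < ((k : ℝ) + 1) * t := by positivity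
  rw [negLogOneSubExp, Complex.ofReal_neg, Complex.ofReal_log (one_sub_exp_neg_pos hk).le,
    ← Complex.exp_nat_mul]
  push_cast
  ring_nf

theorem KLog_neg_ofReal {m : ℕ} (hm : m ≠ 0) {w : ℝ} (hw : 0 < w) :
    KLog m (-(w : ℂ)) = ((Real.exp ((logQGamma 1 (w / m) - logQGamma 1 (w / 2)) / 2 +
      (m + 2) / 4 * logQGamma 1 w) : ℝ) : ℂ) := by
  have hm' : (0 : ℝ) < m := by exact_mod_cast Nat.pos_of_ne_zero hm
  have e1 : -(w : ℂ) / m = -((w / m : ℝ) : ℂ) := by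
    push_cast
    ring
  have e2 : -(w : ℂ) / 2 = -((w / 2 : ℝ) : ℂ) := by
    push_cast
    ring
  rw [KLog, e1, e2, logPartGF_exp_neg (div_pos hw hm'), logPartGF_exp_neg (half_pos hw),
    logPartGF_exp_neg hw, ← Complex.exp_add]
  push_cast
  rfl

theorem lambertTerm_neg_ofReal (b w : ℝ) :
    lambertTerm b (-(w : ℂ)) = ((boseFactor (b * w) / b : ℝ) : ℂ) := by
  rw [lambertTerm, boseFactor, div_div, mul_comm (1 - Real.exp (-(b * w)))]
  push_cast
  rw [mul_neg]

theorem LLog_neg_ofReal (m : ℕ) (w : ℝ) :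
    LLog m (-(w : ℂ)) = ((Real.exp (-(1 / (2 * m)) * lambertSum m w) : ℝ) : ℂ) := by
  rw [LLog, Complex.ofReal_exp, lambertSum]
  simp only [lambertTerm_neg_ofReal]
  push_cast
  rfl

theorem hasSum_bppCount_eq {n : ℕ} (hn : n ≠ 0) {T : ℝ} (hT : 0 < T) :
    HasSum (fun k => (bppCount (n + 1) k : ℂ) * Complex.exp (-(T : ℂ)) ^ k)
      ((gConst (n + 1) : ℂ) * (T : ℂ) ^ (1 / 2 : ℂ) *
          Complex.exp ((varpiConst (n + 1) : ℂ) / T + (phiConst (n + 1) : ℂ) * T) *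
          KLog (n + 1) (-(4 * (Real.pi : ℂ) ^ 2 / T)) *
          LLog (n + 1) (-(4 * (Real.pi : ℂ) ^ 2 / T))) := by
  have hpi := Real.pi_pos
  have h := hasSum_bppCount_mul_exp hn hT
  rw [show ∑ j ∈ range n, ∑ k ∈ range j,
        logQGamma ((((k : ℝ) + 1) + (j + 1)) / (2 * (n + 1))) (2 * (n + 1) * T) =
      pairSum n (fun r => logQGamma (r / (2 * (n + 1))) (2 * (n + 1) * T)) from rfl,
    logQGamma_add_pairSum n hT, Real.exp_add, Real.exp_add, Real.exp_add, Real.exp_add,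
    Real.exp_log (gConst_pos n)] at h
  have h2 := Complex.hasSum_ofReal.2 h
  have e1 : (4 * (Real.pi : ℂ) ^ 2 / T) = ((4 * Real.pi ^ 2 / T : ℝ) : ℂ) := by push_cast; rfl
  have e2 : (T : ℂ) ^ (1 / 2 : ℂ) = ((Real.exp (Real.log T / 2) : ℝ) : ℂ) := by
    rw [Complex.cpow_def_of_ne_zero (by exact_mod_cast hT.ne'), ← Complex.ofReal_log hT.le]
    push_cast
    ring_nf
  have e3 : Complex.exp ((varpiConst (n + 1) : ℂ) / T + (phiConst (n + 1) : ℂ) * T) =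
      ((Real.exp (varpiConst (n + 1) / T + phiConst (n + 1) * T) : ℝ) : ℂ) := by
    push_cast
    rfl
  rw [e1, e2, e3, KLog_neg_ofReal (Nat.succ_ne_zero n) (by positivity), LLog_neg_ofReal,
    ← Complex.ofReal_mul, ← Complex.ofReal_mul, ← Complex.ofReal_mul, ← Complex.ofReal_mul]
  refine h2.congr_fun fun k => ?_
  push_cast
  rfl

end RealValues

section Analyticity

theorem differentiableOn_KLog {m : ℕ} (hm : m ≠ 0) :
    DifferentiableOn ℂ (KLog m) {s | s.re < 0} := by
  have hm' : (0 : ℝ) < m := by exact_mod_cast Nat.pos_of_ne_zero hm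
  have key : ∀ c : ℝ, 0 < c →
      DifferentiableOn ℂ (fun s : ℂ => logPartGF (Complex.exp (s / c))) {s | s.re < 0} := by
    intro c hc
    refine analyticOnNhd_logPartGF.differentiableOn.comp (by fun_prop) fun s hs => ?_
    rw [mem_ball_zero_iff, Complex.norm_exp, Complex.div_ofReal_re, Real.exp_lt_one_iff]
    exact div_neg_of_neg_of_pos hs hc
  have h1 := key m hm'
  have h2 := key 2 two_pos
  have h3 := key 1 one_pos
  push_cast at h1 h2 h3
  simp only [div_one] at h3
  exact (((h1.sub h2).div_const 2).cexp).mul ((h3.const_mul _).cexp)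

theorem lambertExponent_pos {m l : ℕ} (hm : 0 < m) (hl : 1 ≤ l) (j : ℕ) :
    0 < lambertExponent m l j := by
  have hm' : (0 : ℝ) < m := by exact_mod_cast hm
  have hl' : (1 : ℝ) ≤ l := by exact_mod_cast hl
  have : 0 < (2 * (l : ℝ) - 1) / (2 * m) := div_pos (by linarith) (by linarith)
  rw [lambertExponent]
  positivity

theorem norm_lambertTerm_le {b d : ℝ} (hb : 0 < b) (hd : 0 < d) {s : ℂ} (hs : s.re ≤ -d) :
    ‖lambertTerm b s‖ ≤ boseFactor (b * d) / b := by
  have h1 : ‖Complex.exp (b * s)‖ ≤ Real.exp (-(b * d)) := by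
    rw [Complex.norm_exp, Complex.re_ofReal_mul]
    exact Real.exp_le_exp.2 (by nlinarith)
  have h2 : 1 - Real.exp (-(b * d)) ≤ ‖1 - Complex.exp (b * s)‖ := by
    have := norm_sub_norm_le (1 : ℂ) (Complex.exp (b * s))
    rw [norm_one] at this
    linarith
  rw [lambertTerm, boseFactor, norm_div, norm_mul, Complex.norm_real, Real.norm_of_nonneg hb.le,
    div_div, mul_comm _ b]
  refine div_le_div₀ (Real.exp_nonneg _) h1 (mul_pos hb (one_sub_exp_neg_pos (mul_pos hb hd))) ?_
  exact mul_le_mul_of_nonneg_left h2 hb.le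

theorem differentiableOn_tsum_lambertTerm {m l : ℕ} (hm : 0 < m) (hl : 1 ≤ l) :
    DifferentiableOn ℂ (fun s => ∑' j : ℕ, lambertTerm (lambertExponent m l j) s)
      {s | s.re < 0} := by
  intro s hs
  have hs' : s.re < 0 := hs
  -- In the half-plane `Re < -d`, which contains `s`, every term is dominated by its value at the
  -- real point `-d`.
  set d := -s.re / 2 with hd
  have hd0 : 0 < d := by linarith
  have hopen : IsOpen {s : ℂ | s.re < -d} := isOpen_lt Complex.continuous_re continuous_const
  have hsum : Summable fun j : ℕ => boseFactor (lambertExponent m l j * d) / lambertExponent m l j := by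
    have h := summable_lambertTerm hm hl (s := -(d : ℂ)) (by simpa using hd0)
    simp only [lambertTerm_neg_ofReal] at h
    exact Complex.summable_ofReal.1 h
  have key : DifferentiableOn ℂ (fun s => ∑' j : ℕ, lambertTerm (lambertExponent m l j) s)
      {s | s.re < -d} := by
    refine Complex.differentiableOn_tsum_of_summable_norm hsum (fun j => ?_) hopen
      fun j w hw => norm_lambertTerm_le (lambertExponent_pos hm hl j) hd0 (le_of_lt hw)
    have hb := lambertExponent_pos hm hl j
    refine DifferentiableOn.div (by fun_prop) (by fun_prop) fun w hw => ?_
    have hb' : ((lambertExponent m l j : ℝ) : ℂ) ≠ 0 := by exact_mod_cast hb.ne'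
    refine mul_ne_zero hb' (sub_ne_zero.2 fun h => ?_)
    have h2 := congrArg norm h
    rw [norm_one, Complex.norm_exp, Complex.re_ofReal_mul, eq_comm, Real.exp_eq_one_iff] at h2
    have hw' : w.re < 0 := lt_trans hw (by linarith)
    exact (mul_neg_of_pos_of_neg hb hw').ne h2
  exact (key.differentiableAt (hopen.mem_nhds (by
    change s.re < -d
    linarith))).differentiableWithinAt

theorem differentiableOn_LLog {m : ℕ} (hm : 0 < m) :
    DifferentiableOn ℂ (LLog m) {s | s.re < 0} := by
  refine DifferentiableOn.cexp (DifferentiableOn.const_mul ?_ _)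
  refine DifferentiableOn.fun_sum fun l hl => ?_
  exact (differentiableOn_tsum_lambertTerm hm (Finset.mem_Icc.1 hl).1).const_mul _

theorem summable_bppCount {n : ℕ} (hn : n ≠ 0) {τ : ℂ} (hτ : 0 < τ.re) :
    Summable fun k : ℕ => (bppCount (n + 1) k : ℂ) * Complex.exp (-τ) ^ k := by
  refine Summable.of_norm_bounded (hasSum_bppCount_mul_exp hn hτ).summable fun k => ?_
  rw [norm_mul, norm_pow, Complex.norm_exp, Complex.norm_natCast, Complex.neg_re]

theorem differentiableOn_bppGF {n : ℕ} (hn : n ≠ 0) :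
    DifferentiableOn ℂ (fun τ => bppGF (n + 1) (Complex.exp (-τ))) {τ | 0 < τ.re} := by
  intro τ hτ
  have hτ' : 0 < τ.re := hτ
  have hopen : IsOpen {s : ℂ | τ.re / 2 < s.re} := isOpen_lt continuous_const Complex.continuous_re
  have key : DifferentiableOn ℂ (fun τ => bppGF (n + 1) (Complex.exp (-τ)))
      {s | τ.re / 2 < s.re} := by
    refine Complex.differentiableOn_tsum_of_summable_norm
      (hasSum_bppCount_mul_exp hn (half_pos hτ')).summable (fun k => by fun_prop) hopen
      fun k w hw => ?_
    have hw' : τ.re / 2 < w.re := hw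
    rw [norm_mul, norm_pow, Complex.norm_exp, Complex.norm_natCast, Complex.neg_re]
    gcongr
  exact (key.differentiableAt (hopen.mem_nhds (by
    change τ.re / 2 < τ.re
    linarith))).differentiableWithinAt

theorem neg_div_re_neg {τ : ℂ} (hτ : 0 < τ.re) : (-(4 * (Real.pi : ℂ) ^ 2 / τ)).re < 0 := by
  have hpi := Real.pi_pos
  have e : 4 * (Real.pi : ℂ) ^ 2 / τ = ((4 * Real.pi ^ 2 : ℝ) : ℂ) * τ⁻¹ := by
    push_cast
    rw [div_eq_mul_inv]
  have hn : 0 < Complex.normSq τ := Complex.normSq_pos.2 fun h => by simp [h] at hτ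
  rw [e, Complex.neg_re, Complex.re_ofReal_mul, Complex.inv_re]
  exact neg_neg_of_pos (by positivity)

theorem differentiableOn_transformed {m : ℕ} (hm : m ≠ 0) :
    DifferentiableOn ℂ (fun τ : ℂ => (gConst m : ℂ) * τ ^ (1 / 2 : ℂ) *
      Complex.exp ((varpiConst m : ℂ) / τ + (phiConst m : ℂ) * τ) *
      KLog m (-(4 * (Real.pi : ℂ) ^ 2 / τ)) * LLog m (-(4 * (Real.pi : ℂ) ^ 2 / τ)))
      {τ | 0 < τ.re} := by
  have hne : ∀ τ ∈ {τ : ℂ | 0 < τ.re}, τ ≠ 0 := fun τ hτ h => by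
    rw [Set.mem_ofPred_eq, h] at hτ
    simp at hτ
  have hs : DifferentiableOn ℂ (fun τ : ℂ => -(4 * (Real.pi : ℂ) ^ 2 / τ)) {τ | 0 < τ.re} :=
    ((differentiableOn_const _).div differentiableOn_id hne).neg
  have hmaps : Set.MapsTo (fun τ : ℂ => -(4 * (Real.pi : ℂ) ^ 2 / τ)) {τ | 0 < τ.re}
      {s | s.re < 0} := fun τ hτ => neg_div_re_neg hτ
  have h1 : DifferentiableOn ℂ (fun τ : ℂ => τ ^ (1 / 2 : ℂ)) {τ | 0 < τ.re} :=
    differentiableOn_id.cpow_const fun τ hτ => Or.inl hτ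
  have h2 : DifferentiableOn ℂ (fun τ : ℂ =>
      Complex.exp ((varpiConst m : ℂ) / τ + (phiConst m : ℂ) * τ)) {τ | 0 < τ.re} :=
    (((differentiableOn_const _).div differentiableOn_id hne).add
      (differentiableOn_id.const_mul _)).cexp
  exact (((h1.const_mul _).mul h2).mul ((differentiableOn_KLog hm).comp hs hmaps)).mul
    ((differentiableOn_LLog (Nat.pos_of_ne_zero hm)).comp hs hmaps)

/-- Identity theorem in the right half-plane: both sides are holomorphic there and agree at the
positive reals, which accumulate at 1. -/
theorem bppGF_exp_neg {n : ℕ} (hn : n ≠ 0) {τ : ℂ} (hτ : 0 < τ.re) :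
    bppGF (n + 1) (Complex.exp (-τ)) = (gConst (n + 1) : ℂ) * τ ^ (1 / 2 : ℂ) *
      Complex.exp ((varpiConst (n + 1) : ℂ) / τ + (phiConst (n + 1) : ℂ) * τ) *
      KLog (n + 1) (-(4 * (Real.pi : ℂ) ^ 2 / τ)) *
      LLog (n + 1) (-(4 * (Real.pi : ℂ) ^ 2 / τ)) := by
  have hopen : IsOpen {τ : ℂ | 0 < τ.re} := isOpen_lt continuous_const Complex.continuous_re
  have hconn : IsPreconnected {τ : ℂ | 0 < τ.re} :=
    (convex_halfSpace_re_gt 0).isPreconnected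
  refine ((differentiableOn_bppGF hn).analyticOnNhd hopen).eqOn_of_preconnected_of_frequently_eq
    ((differentiableOn_transformed (Nat.succ_ne_zero n)).analyticOnNhd hopen) hconn
    (z₀ := ((1 : ℝ) : ℂ)) (by simp) ?_ hτ
  have ht : Tendsto (fun x : ℝ => (x : ℂ)) (𝓝[≠] 1) (𝓝[≠] ((1 : ℝ) : ℂ)) :=
    Complex.continuous_ofReal.continuousAt.continuousWithinAt.tendsto_nhdsWithin
      fun x hx => by simpa using hx
  refine ht.frequently (Eventually.frequently ?_)
  filter_upwards [mem_nhdsWithin_of_mem_nhds (Ioi_mem_nhds (zero_lt_one' ℝ))] with x hx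
  exact (hasSum_bppCount_eq hn hx).tsum_eq

theorem mem_slitPlane_of_mem_slitDisc {z : ℂ} (hz : z ∈ slitDisc) : z ∈ Complex.slitPlane := by
  rw [Complex.mem_slitPlane_iff_not_le_zero, Complex.le_def]
  rintro ⟨h1, h2⟩
  have h3 : z = (z.re : ℂ) := Complex.ext rfl (by simpa using h2)
  refine hz.2 z.re ⟨?_, by simpa using h1⟩ h3
  have := (Complex.abs_re_le_norm z).trans hz.1.le
  exact (abs_le.1 this).1

theorem log_re_neg_of_mem_slitDisc {z : ℂ} (hz : z ∈ slitDisc) : (Complex.log z).re < 0 := by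
  rw [Complex.log_re]
  exact Real.log_neg (norm_pos_iff.2 (Complex.slitPlane_ne_zero (mem_slitPlane_of_mem_slitDisc hz)))
    hz.1

theorem analyticOnNhd_comp_log {f : ℂ → ℂ} (hf : DifferentiableOn ℂ f {s | s.re < 0}) :
    AnalyticOnNhd ℂ (fun z => f (Complex.log z)) slitDisc := fun _ hz =>
  AnalyticAt.fun_comp (hf.analyticOnNhd (isOpen_lt Complex.continuous_re continuous_const) _
    (log_re_neg_of_mem_slitDisc hz)) (analyticAt_clog (mem_slitPlane_of_mem_slitDisc hz))

end Analyticity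

end

end

theorem mainTheorem2 (m : ℕ) (hm : 3 ≤ m) :
    (∀ τ : ℂ, 0 < τ.re →
      (Summable fun n : ℕ => (bppCount m n : ℂ) * Complex.exp (-τ) ^ n) ∧
      bppGF m (Complex.exp (-τ)) =
        (gConst m : ℂ) * τ ^ (1 / 2 : ℂ) *
          Complex.exp ((varpiConst m : ℂ) / τ + (phiConst m : ℂ) * τ) *
          KLog m (-(4 * (Real.pi : ℂ) ^ 2 / τ)) * LLog m (-(4 * (Real.pi : ℂ) ^ 2 / τ))) ∧
    (∀ τ : ℂ, 0 < τ.re → |(4 * (Real.pi : ℂ) ^ 2 / τ).im| < Real.pi →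
      bppGF m (Complex.exp (-τ)) =
        (gConst m : ℂ) * τ ^ (1 / 2 : ℂ) *
          Complex.exp ((varpiConst m : ℂ) / τ + (phiConst m : ℂ) * τ) *
          KFun m (Complex.exp (-(4 * (Real.pi : ℂ) ^ 2 / τ))) *
          LFun m (Complex.exp (-(4 * (Real.pi : ℂ) ^ 2 / τ)))) ∧
    AnalyticOnNhd ℂ (KFun m) slitDisc ∧ AnalyticOnNhd ℂ (LFun m) slitDisc := by
  obtain ⟨n, rfl⟩ : ∃ n, m = n + 1 := ⟨m - 1, by omega⟩
  have hn : n ≠ 0 := by omega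
  refine ⟨fun τ hτ => ⟨summable_bppCount hn hτ, bppGF_exp_neg hn hτ⟩, fun τ hτ him => ?_,
    analyticOnNhd_comp_log (differentiableOn_KLog (Nat.succ_ne_zero n)),
    analyticOnNhd_comp_log (differentiableOn_LLog n.succ_pos)⟩
  -- The bound on the imaginary part places the exponent in the strip where the principal logarithm
  -- inverts the exponential.
  have hlog : Complex.log (Complex.exp (-(4 * (Real.pi : ℂ) ^ 2 / τ))) =
      -(4 * (Real.pi : ℂ) ^ 2 / τ) := by
    have h := abs_lt.1 him
    refine Complex.log_exp ?_ ?_ <;> rw [Complex.neg_im] <;> linarith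
  rw [KFun, LFun, hlog]
  exact bppGF_exp_neg hn hτ
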